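/- Let $\Omega\subset\mathbb R^d$ be compact and convex, let $0<\alpha<1$, and let $\mathcal P(\Omega)$ be the set of Borel probability measures on $\Omega$ with the weak* topology. Given $\mu_0,\mu_1\in\mathcal P(\Omega)$, let $\mathfrak D(\mu_0,\mu_1)$ be the set of pairs $(\rho,q)$ such that * $\rho\in C([0,1];\mathcal P(\Omega))$ with $\rho_0=\mu_0$ and $\rho_1=\mu_1$; * $q\in L^1([0,1];\mathcal M(\Omega;\mathbb R^d))$, that is, $q=(q_t)_{t\in[0,1]}$ is a weakly measurable family of $\mathbb R^d$-valued Borel measures on $\Omega$ with $\int_0^1|q_t|(\Omega)\,dt<\infty$, where $|q_t|$ is the total variation measure; * the continuity equation $\partial_t\rho+\operatorname{div}_xq=0$ holds with no flux through $\partial\Omega$, in the weak sense that $$\int_0^1\Big[\int_\Omega\partial_t\phi(t,x)\,d\rho_t(x)+\int_\Omega D_x\phi(t,x)\cdot dq_t(x)\Big]dt=0$$ for every $\phi\in C^\infty(\mathbb R\times\mathbb R^d)$ with $\phi(0,x)=\phi(1,x)=0$ for all $x\in\Omega$. For a positive Borel measure $\lambda$ on $\Omega$ put $G_\alpha(\lambda)=\sum_{x\in\Omega}\lambda(\{x\})^\alpha$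 if $\lambda$ is purely atomic (concentrated on a countable set), and $G_\alpha(\lambda)=+\infty$ otherwise. For $\rho\in\mathcal P(\Omega)$ and an $\mathbb R^d$-valued measure $q$ on $\Omega$ put $$F(\rho,q)=\begin{cases}G_\alpha\big(|v|^{1/\alpha}\rho\big)&\text{if } q\ll\rho,\ v=\dfrac{dq}{d\rho},\\ +\infty&\text{otherwise,}\end{cases}$$ so that $F(\rho,q)=\sum_{x\in\Omega}|v(x)|\,\rho(\{x\})^\alpha$ when $q\ll\rho$ is purely atomic. Let $\mathcal F(\rho,q)=\int_0^1F(\rho_t,q_t)\,dt\in[0,+\infty]$. Then, for every $\mu_0,\mu_1\in\mathcal P(\Omega)$, the dynamical branched transport problem $$\mathcal B_\alpha(\mu_0,\mu_1)=\min\big\{\mathcal F(\rho,q):(\rho,q)\in\mathfrak D(\mu_0,\mu_1)\big\}$$ has a minimizer: there is $(\rho,q)\in\mathfrak D(\mu_0,\mu_1)$ with $\mathcal F(\rho,q)\le\mathcal F(\tilde\rho,\tilde q)$ for every $(\tilde\rho,\tilde q)\in\mathfrak D(\mu_0,\mu_1)$. (The minimal value may be $+\infty$.) -/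

import Mathlib

open MeasureTheory Set Filter Topology
open scoped ENNReal unitInterval ContDiff

noncomputable section

namespace BranchedTransport

/-- A functional on positive measures: `G_α(λ) = ∑_x λ({x})^α` if `λ` is purely atomic (that is,
concentrated on a countable set), and `+∞` otherwise. -/
def atomicEnergy {X : Type*} [MeasurableSpace X] (α : ℝ) (lam : Measure X) : ℝ≥0∞ :=
  open Classical in
  if ∃ S : Set X, S.Countable ∧ lam Sᶜ = 0 then ∑' x : X, lam {x} ^ α else ⊤

/-- The `i`-th component of an `ℝ^d`-valued measure. -/
def component {d : ℕ} {X : Type*} [MeasurableSpace X]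
    (q : VectorMeasure X (EuclideanSpace ℝ (Fin d))) (i : Fin d) : SignedMeasure X :=
  q.mapRange (EuclideanSpace.proj i : EuclideanSpace ℝ (Fin d) →L[ℝ] ℝ).toAddMonoidHom
    (EuclideanSpace.proj i : EuclideanSpace ℝ (Fin d) →L[ℝ] ℝ).continuous

/-- The velocity `v = dq/dρ`: the Radon–Nikodym derivative, taken component by component. -/
def velocity {d : ℕ} {X : Type*} [MeasurableSpace X] (ρ : Measure X)
    (q : VectorMeasure X (EuclideanSpace ℝ (Fin d))) : X → EuclideanSpace ℝ (Fin d) :=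
  fun x => WithLp.toLp 2 fun i => (component q i).rnDeriv ρ x

/-- The instantaneous cost: `F(ρ, q) = G_α(|v|^{1/α} ρ)` if `q ≪ ρ`, with `v = dq/dρ`, and `+∞`
otherwise. -/
def instantCost {d : ℕ} {X : Type*} [MeasurableSpace X] (α : ℝ) (ρ : Measure X)
    (q : VectorMeasure X (EuclideanSpace ℝ (Fin d))) : ℝ≥0∞ :=
  open Classical in
  if q ≪ᵥ ρ.toENNRealVectorMeasure then
    atomicEnergy α (ρ.withDensity fun x => ‖velocity ρ q x‖ₑ ^ (1 / α))
  else ⊤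

/-- Pairs `(ρ, q)`: a weakly continuous curve `ρ` of probability measures on `Ω`, and a family
`q = (q_t)` of `ℝ^d`-valued (countably additive, Borel) measures on `Ω`, `t ∈ [0, 1]`. -/
abbrev Pair {d : ℕ} (Ω : Set (EuclideanSpace ℝ (Fin d))) : Type :=
  C(I, ProbabilityMeasure Ω) × (I → VectorMeasure Ω (EuclideanSpace ℝ (Fin d)))

/-- `q ∈ L¹([0,1]; M(Ω; ℝ^d))`: the family is weakly measurable in time and the total mass
`|q_t|(Ω)` is integrable in time. -/
def IsL1Flux {d : ℕ} {Ω : Set (EuclideanSpace ℝ (Fin d))}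
    (q : I → VectorMeasure Ω (EuclideanSpace ℝ (Fin d))) : Prop :=
  (∀ B : Set Ω, MeasurableSet B → AEMeasurable fun t => q t B) ∧
    ∫⁻ t, (q t).variation univ < ⊤

/-- The weak form of the continuity equation `∂_t ρ + div q = 0` with the no-flux boundary
condition: test functions are smooth, vanish on `Ω` at `t = 0` and `t = 1`, and need not vanish
near the boundary of `Ω`. The differential `D_x φ` is paired with `q_t` by duality. -/
def ContinuityEquation {d : ℕ} {Ω : Set (EuclideanSpace ℝ (Fin d))} (p : Pair Ω) : Prop :=
  ∀ φ : ℝ × EuclideanSpace ℝ (Fin d) → ℝ, ContDiff ℝ ∞ φ →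
    (∀ x ∈ Ω, φ (0, x) = 0 ∧ φ (1, x) = 0) →
    ∫ t : I,
      ((∫ x : Ω, deriv (fun s : ℝ => φ (s, (x : EuclideanSpace ℝ (Fin d)))) (t : ℝ)
          ∂(p.1 t : Measure Ω)) +
        ∫ᵛ x : Ω, fderiv ℝ (fun y : EuclideanSpace ℝ (Fin d) => φ ((t : ℝ), y))
            (x : EuclideanSpace ℝ (Fin d))
          ∂[ContinuousLinearMap.id ℝ (EuclideanSpace ℝ (Fin d) →L[ℝ] ℝ); p.2 t]) = 0

/-- The admissible pairs joining `μ₀` to `μ₁`. -/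
def admissible {d : ℕ} {Ω : Set (EuclideanSpace ℝ (Fin d))} (μ₀ μ₁ : ProbabilityMeasure Ω) :
    Set (Pair Ω) :=
  {p | IsL1Flux p.2 ∧ ContinuityEquation p ∧ p.1 0 = μ₀ ∧ p.1 1 = μ₁}

/-- The total cost `∫₀¹ F(ρ_t, q_t) dt`. -/
def totalCost {d : ℕ} {Ω : Set (EuclideanSpace ℝ (Fin d))} (α : ℝ) (p : Pair Ω) : ℝ≥0∞ :=
  ∫⁻ t : I, instantCost α (p.1 t : Measure Ω) (p.2 t)

end BranchedTransport

end

set_option linter.unusedSectionVars false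

/-! The direct method applies once the cost is put in a lower semicontinuous form. At an atom,
`(|v|^{1/α} ρ{x})^α = ρ{x}^{α-1} · |v| ρ{x}`. Hence `F(ρ, q)` is the least integral of the weight
`ρ{x}^{α-1}`, infinite off the atoms of `ρ`, over positive measures `ν` with `|q(A)| ≤ ν(A)` for
every Borel `A` (`instantCost_le_lintegral`, `exists_dominating_lintegral_le`). The weight is at
least 1, so a bound on the cost bounds the mass of the flux. It is also a limit from below of
weights that are jointly continuous in `(ρ, x)` (`smoothedWeight`).

A bound on the flux mass alone would let the flux concentrate in time. The cost is 1-homogeneous in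
`q`, so time may be reparametrized by the distribution function of the mass density plus 1
(`exists_timeChange`). The mass then has a bounded density in time: the curves become equi-Lipschitz
against smooth functions (`lipschitz_timeChange`), and limits keep a time marginal below a multiple
of Lebesgue measure.

The fluxes are discretized in space and encoded as positive measures on times, positions and
directions, where bounded mass gives weak compactness. Along an ultrafilter the continuity equation
passes to the limit (`liftedEquation_of_tendsto`). So does the bound on the integral of each
smoothed weight (`lintegral_smoothedWeight_le_of_tendsto`); Fatou's lemma then restores the true
weight. Disintegrating the limit in time and averaging directions gives a flux, dominated by the
position marginals, and hence the cost bound (`exists_flux_of_liftedEquation`). That some admissible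
pair exists at all comes from displacement interpolation (`exists_admissible`). -/

noncomputable section

namespace BranchedTransport

/-! ### Riemann sums against vector measures. -/

section RiemannSums

variable {X : Type*} [MeasurableSpace X] {E : Type*} [NormedAddCommGroup E] [NormedSpace ℝ E]

/-- An `ℝ^d`-valued measure has finite total variation. -/
instance isFiniteMeasure_variation {d : ℕ} (q : VectorMeasure X (EuclideanSpace ℝ (Fin d))) :
    IsFiniteMeasure q.variation := by
  have h : q.variation ≤ ∑ i, (component q i).totalVariation := by
    refine VectorMeasure.variation_le_of_forall_enorm_le fun s hs => ?_
    rw [Measure.finsetSum_apply]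
    have h1 : q s = ∑ i, EuclideanSpace.single i (q s i) := by
      ext j; simp [Finset.sum_apply, Pi.single_apply]
    calc ‖q s‖ₑ ≤ ∑ i, ‖EuclideanSpace.single i (q s i)‖ₑ := by
          conv_lhs => rw [h1]
          exact enorm_sum_le _ _
      _ ≤ ∑ i, (component q i).totalVariation s := by
          refine Finset.sum_le_sum fun i _ => ?_
          have : ‖EuclideanSpace.single i (q s i)‖ₑ = ‖component q i s‖ₑ := by
            rw [← enorm_norm, PiLp.norm_single, enorm_norm]; rfl
          rw [this]
          exact SignedMeasure.enorm_le_totalVariation _ _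
  exact isFiniteMeasure_of_le _ h

/-- The Riemann sum of a function `f` with values in the dual, against a vector measure, associated
with the partition into the fibres of a simple function `π`. -/
def riemannSum (q : VectorMeasure X E) (π : SimpleFunc X X) (f : X → E →L[ℝ] ℝ) : ℝ :=
  ∑ y ∈ π.range, f y (q (π ⁻¹' {y}))

/-- The variation of a vector measure along the partition into the fibres of `π`. -/
def partitionMass (q : VectorMeasure X E) (π : SimpleFunc X X) : ℝ≥0∞ :=
  ∑ y ∈ π.range, ‖q (π ⁻¹' {y})‖ₑ

/-- Domination set by set is all that is needed to compare a weighted partition sum with an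
integral. It is used both for masses and for costs, with `ν` not necessarily the variation of `q`.
-/
lemma sum_enorm_fiber_le {q : VectorMeasure X E} {ν : Measure X}
    (h : ∀ A, MeasurableSet A → ‖q A‖ₑ ≤ ν A) (π : SimpleFunc X X) (c : X → ℝ≥0∞) :
    ∑ y ∈ π.range, c y * ‖q (π ⁻¹' {y})‖ₑ ≤ ∫⁻ x, c (π x) ∂ν := by
  have : ∫⁻ x, c (π x) ∂ν = ∑ y ∈ π.range, c y * ν (π ⁻¹' {y}) := by
    rw [← SimpleFunc.map_lintegral, ← SimpleFunc.lintegral_eq_lintegral]; rfl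
  rw [this]
  gcongr with y hy
  exact h _ (π.measurableSet_fiber y)

lemma partitionMass_le {q : VectorMeasure X E} {ν : Measure X}
    (h : ∀ A, MeasurableSet A → ‖q A‖ₑ ≤ ν A) (π : SimpleFunc X X) :
    partitionMass q π ≤ ν univ := by
  simpa [partitionMass] using sum_enorm_fiber_le h π (fun _ => 1)

lemma enorm_riemannSum_le (q : VectorMeasure X E) (π : SimpleFunc X X) {f : X → E →L[ℝ] ℝ}
    {C : ℝ≥0∞} (hf : ∀ x, ‖f x‖ₑ ≤ C) : ‖riemannSum q π f‖ₑ ≤ C * partitionMass q π := by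
  unfold riemannSum partitionMass
  refine (enorm_sum_le _ _).trans ?_
  rw [Finset.mul_sum]
  refine Finset.sum_le_sum fun y _ => ?_
  exact ((f y).le_opENorm _).trans (by gcongr; exact hf y)

lemma integral_comp_simpleFunc (q : VectorMeasure X E) [IsFiniteMeasure q.variation]
    (π : SimpleFunc X X) (f : X → E →L[ℝ] ℝ) :
    ∫ᵛ x, f (π x) ∂[ContinuousLinearMap.id ℝ (E →L[ℝ] ℝ); q] = riemannSum q π f := by
  have h1 : (fun x => f (π x)) =
      fun x => ∑ y ∈ π.range, (π ⁻¹' {y}).indicator (fun _ => f y) x := by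
    ext1 x
    rw [Finset.sum_eq_single (π x)]
    · simp
    · intro y _ hy
      simp [Ne.symm hy]
    · intro h; exact absurd (π.mem_range_self x) h
  rw [h1, VectorMeasure.integral_finsetSum]
  · refine Finset.sum_congr rfl fun y _ => ?_
    rw [VectorMeasure.integral_eq_setToFun,
      setToFun_indicator_const _ (π.measurableSet_fiber y) (by finiteness)]
    rfl
  · intro y _
    exact (integrable_const (f y)).indicator (π.measurableSet_fiber y)

end RiemannSums

/-! ### Fine finite partitions of a compact space. -/

section Mesh

variable {X : Type*} [MetricSpace X] [CompactSpace X] [MeasurableSpace X] [BorelSpace X]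
  {E : Type*} [NormedAddCommGroup E] [NormedSpace ℝ E]

lemma exists_simpleFunc_dist_le [Nonempty X] {ε : ℝ} (hε : 0 < ε) :
    ∃ π : SimpleFunc X X, ∀ x, dist (π x) x ≤ ε := by
  obtain ⟨e, he⟩ := TopologicalSpace.exists_dense_seq X
  have hc : (univ : Set X) ⊆ ⋃ n, Metric.ball (e n) ε := by
    intro x _
    obtain ⟨n, hn⟩ := he.exists_dist_lt x hε
    exact mem_iUnion.2 ⟨n, hn⟩
  obtain ⟨t, ht⟩ := isCompact_univ.elim_finite_subcover _ (fun n => Metric.isOpen_ball) hc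
  refine ⟨SimpleFunc.nearestPt e (t.sup id), fun x => ?_⟩
  obtain ⟨n, hn, hx⟩ : ∃ n ∈ t, x ∈ Metric.ball (e n) ε := by simpa using ht (mem_univ x)
  have h1 := SimpleFunc.edist_nearestPt_le e x (Finset.le_sup (f := id) hn)
  rw [edist_dist, edist_dist, ENNReal.ofReal_le_ofReal_iff dist_nonneg] at h1
  exact h1.trans (by rw [dist_comm]; exact (Metric.mem_ball.1 hx).le)

variable (X) in
/-- A sequence of simple maps `X → X` that are uniformly close to the identity. -/
def mesh [Nonempty X] (n : ℕ) : SimpleFunc X X :=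
  (exists_simpleFunc_dist_le (X := X) (ε := 1 / (n + 1)) (by positivity)).choose

lemma dist_mesh_le [Nonempty X] (n : ℕ) (x : X) : dist (mesh X n x) x ≤ 1 / (n + 1) :=
  (exists_simpleFunc_dist_le (X := X) (ε := 1 / (n + 1)) (by positivity)).choose_spec x

lemma tendsto_mesh [Nonempty X] (x : X) : Tendsto (fun n => mesh X n x) atTop (𝓝 x) :=
  tendsto_iff_dist_tendsto_zero.2 <| squeeze_zero (fun _ => dist_nonneg)
    (fun n => dist_mesh_le n x) tendsto_one_div_add_atTop_nhds_zero_nat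

/-- A lower approximation of the total variation of `q`, taken along the partitions `mesh X n`. -/
def massBound [Nonempty X] (q : VectorMeasure X E) : ℝ≥0∞ := ⨆ n, partitionMass q (mesh X n)

lemma massBound_le [Nonempty X] {q : VectorMeasure X E} {ν : Measure X}
    (h : ∀ A, MeasurableSet A → ‖q A‖ₑ ≤ ν A) : massBound q ≤ ν univ :=
  iSup_le fun _ => partitionMass_le h _

lemma massBound_le_variation [Nonempty X] (q : VectorMeasure X E) :
    massBound q ≤ q.variation univ :=
  massBound_le fun A _ => VectorMeasure.enorm_measure_le_variation q A

lemma integrable_of_continuous {q : VectorMeasure X E} [IsFiniteMeasure q.variation]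
    {F : Type*} [NormedAddCommGroup F] {f : X → F} (hf : Continuous f) : q.Integrable f :=
  hf.integrable_of_hasCompactSupport (HasCompactSupport.of_compactSpace f)

/-- The error is the oscillation of `f` on the fibres times the variation of `q`. It is therefore
uniform over fluxes of bounded mass, which permits a different flux at each mesh scale. -/
lemma enorm_integral_sub_riemannSum_le (q : VectorMeasure X E) [IsFiniteMeasure q.variation]
    (π : SimpleFunc X X) {f : X → E →L[ℝ] ℝ} (hf : Continuous f) {ε : ℝ≥0∞}
    (h : ∀ x, ‖f x - f (π x)‖ₑ ≤ ε) :
    ‖(∫ᵛ x, f x ∂[ContinuousLinearMap.id ℝ (E →L[ℝ] ℝ); q]) - riemannSum q π f‖ₑ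
      ≤ ε * q.variation univ := by
  have hπ : q.Integrable fun x => f (π x) := by
    have : (fun x => f (π x)) = π.map f := rfl
    rw [this]
    exact SimpleFunc.integrable_of_isFiniteMeasure _
  rw [← integral_comp_simpleFunc, ← VectorMeasure.integral_fun_sub (integrable_of_continuous hf) hπ]
  refine (VectorMeasure.enorm_integral_le_of_enorm_le_const (ae_of_all _ h)).trans ?_
  gcongr
  calc ε * ‖ContinuousLinearMap.id ℝ (E →L[ℝ] ℝ)‖ₑ ≤ ε * 1 := by
        gcongr
        rw [← ofReal_norm]
        exact ENNReal.ofReal_le_one.2 (ContinuousLinearMap.norm_id_le)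
    _ = ε := mul_one _

/-- Riemann sums see `q` only through its values on countably many sets, so this limit transfers
measurability in time from those values to integrals. -/
lemma tendsto_riemannSum [Nonempty X] (q : VectorMeasure X E) [IsFiniteMeasure q.variation]
    {f : X → E →L[ℝ] ℝ} (hf : Continuous f) :
    Tendsto (fun n => riemannSum q (mesh X n) f) atTop
      (𝓝 (∫ᵛ x, f x ∂[ContinuousLinearMap.id ℝ (E →L[ℝ] ℝ); q])) := by
  obtain ⟨C, hC⟩ := isCompact_univ.exists_bound_of_continuousOn hf.continuousOn
  simp_rw [← integral_comp_simpleFunc]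
  refine VectorMeasure.tendsto_integral_of_dominated_convergence (fun _ => C) (fun n => ?_)
    (integrable_const _) (fun n => ae_of_all _ fun x => hC _ (mem_univ _))
    (ae_of_all _ fun x => (hf.tendsto x).comp (tendsto_mesh x))
  exact (SimpleFunc.stronglyMeasurable ((mesh X n).map f)).aestronglyMeasurable

/-- The bound for Riemann sums survives the limit. `massBound` is used instead of the variation
because, as a countable supremum, it inherits measurability in time. -/
lemma enorm_integral_le_massBound [Nonempty X] (q : VectorMeasure X E)
    [IsFiniteMeasure q.variation] {f : X → E →L[ℝ] ℝ} (hf : Continuous f) {C : ℝ≥0∞}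
    (h : ∀ x, ‖f x‖ₑ ≤ C) :
    ‖∫ᵛ x, f x ∂[ContinuousLinearMap.id ℝ (E →L[ℝ] ℝ); q]‖ₑ ≤ C * massBound q := by
  refine le_of_tendsto (tendsto_riemannSum q hf).enorm (Eventually.of_forall fun n => ?_)
  refine (enorm_riemannSum_le q _ h).trans ?_
  gcongr
  exact le_iSup (fun n => partitionMass q (mesh X n)) n

end Mesh

/-! ### The instantaneous cost as a weighted mass. -/

section AtomWeight

variable {X : Type*} [MeasurableSpace X] [MeasurableSingletonClass X]

/-- The weight `ρ({x})^{α-1}`, infinite where `ρ` has no atom. -/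
def atomWeight (α : ℝ) (ρ : Measure X) (x : X) : ℝ≥0∞ := ρ {x} ^ (α - 1)

lemma countable_atoms (ρ : Measure X) [IsFiniteMeasure ρ] : {x | ρ {x} ≠ 0}.Countable := by
  have := Measure.countable_meas_pos_of_disjoint_iUnion (μ := ρ) (As := fun x : X => ({x} : Set X))
    (fun x => measurableSet_singleton x) (fun x y h => by simpa using h)
  simpa [pos_iff_ne_zero] using this

lemma one_le_atomWeight {α : ℝ} (hα₁ : α < 1) (ρ : Measure X) [IsProbabilityMeasure ρ] (x : X) :
    1 ≤ atomWeight α ρ x := by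
  unfold atomWeight
  rw [← neg_sub, ENNReal.rpow_neg, ENNReal.one_le_inv]
  exact ENNReal.rpow_le_one prob_le_one (by linarith)

lemma measurable_atomWeight (α : ℝ) (ρ : Measure X) [IsFiniteMeasure ρ] :
    Measurable (atomWeight α ρ) := by
  refine Measurable.pow_const ?_ _
  -- The function `x ↦ ρ {x}` differs from 0 only on a countable set.
  refine (measurable_const (a := (0 : ℝ≥0∞))).measurable_of_countable_ne ?_
  simpa [eq_comm] using countable_atoms ρ

variable {d : ℕ}

lemma measurable_velocity (ρ : Measure X) (q : VectorMeasure X (EuclideanSpace ℝ (Fin d))) :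
    Measurable (velocity ρ q) := by
  unfold velocity
  refine (WithLp.measurable_toLp 2 _).comp ?_
  exact measurable_pi_lambda _ fun i => SignedMeasure.measurable_rnDeriv _ _

lemma integrable_velocity (ρ : Measure X) [IsFiniteMeasure ρ]
    (q : VectorMeasure X (EuclideanSpace ℝ (Fin d))) : Integrable (velocity ρ q) ρ := by
  have h : velocity ρ q =
      fun x => ∑ i, (component q i).rnDeriv ρ x • EuclideanSpace.single i (1 : ℝ) := by
    ext x j
    simp [velocity, Pi.single_apply]
  rw [h]
  exact integrable_finsetSum _ fun i _ => (SignedMeasure.integrable_rnDeriv _ _).smul_const _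

lemma setIntegral_velocity {ρ : Measure X} [IsFiniteMeasure ρ]
    {q : VectorMeasure X (EuclideanSpace ℝ (Fin d))} (h : q ≪ᵥ ρ.toENNRealVectorMeasure)
    {A : Set X} (hA : MeasurableSet A) : ∫ x in A, velocity ρ q x ∂ρ = q A := by
  ext i
  have hc : component q i ≪ᵥ ρ.toENNRealVectorMeasure := by
    intro s hs
    have : component q i s = q s i := rfl
    rw [this, h hs]; rfl
  have h1 := ContinuousLinearMap.integral_comp_comm
    (EuclideanSpace.proj i : EuclideanSpace ℝ (Fin d) →L[ℝ] ℝ)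
    (integrable_velocity ρ q).integrableOn (μ := ρ.restrict A)
  have h2 : ∫ x in A, (component q i).rnDeriv ρ x ∂ρ = component q i A := by
    conv_rhs => rw [← SignedMeasure.withDensityᵥ_rnDeriv_eq _ _ hc]
    rw [withDensityᵥ_apply (SignedMeasure.integrable_rnDeriv _ _) hA]
  exact h1.symm.trans h2

/-- With `a = |v(x)|` and `b = ρ {x}`, this turns the concave cost of an atom into a weight
depending on `ρ` alone times the mass of `|v| ρ`, linear in the flux. -/
lemma rpow_mul_weight {α : ℝ} (hα₀ : 0 < α) {a b : ℝ≥0∞} (hb : b ≠ 0) (hb' : b ≠ ⊤) :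
    (a ^ (1 / α) * b) ^ α = b ^ (α - 1) * (a * b) := by
  rw [ENNReal.mul_rpow_of_nonneg _ _ hα₀.le, ← ENNReal.rpow_mul, one_div_mul_cancel hα₀.ne',
    ENNReal.rpow_one, ENNReal.rpow_sub _ _ hb hb', ENNReal.rpow_one, mul_left_comm,
    ENNReal.div_mul_cancel hb hb']

lemma withDensity_singleton (ρ : Measure X) (f : X → ℝ≥0∞) (x : X) :
    ρ.withDensity f {x} = f x * ρ {x} := by
  rw [withDensity_apply _ (measurableSet_singleton x), lintegral_singleton]

/-- A dominating measure bounds the instantaneous cost. -/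
lemma instantCost_le_lintegral {α : ℝ} (hα₀ : 0 < α) (hα₁ : α < 1) (ρ : Measure X)
    [IsProbabilityMeasure ρ] {q : VectorMeasure X (EuclideanSpace ℝ (Fin d))} {ν : Measure X}
    (h : ∀ A, MeasurableSet A → ‖q A‖ₑ ≤ ν A) :
    instantCost α ρ q ≤ ∫⁻ x, atomWeight α ρ x ∂ν := by
  by_cases htop : ∫⁻ x, atomWeight α ρ x ∂ν = ⊤
  · rw [htop]; exact le_top
  set S : Set X := {x | ρ {x} ≠ 0}
  have hS : S.Countable := countable_atoms ρ
  -- The weight is infinite off the atoms, so a finite integral forces `ν`, and with it `q`, to live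
  -- on the countable set `S`.
  have hν : ν Sᶜ = 0 := by
    have h1 := ae_lt_top (measurable_atomWeight α ρ) htop
    refine measure_mono_null (fun x hx => ?_) h1
    have hx0 : ρ {x} = 0 := by simpa [S] using hx
    simp [atomWeight, hx0, ENNReal.zero_rpow_of_neg (show α - 1 < 0 by linarith)]
  have hq0 : ∀ A, MeasurableSet A → A ⊆ Sᶜ → q A = 0 := fun A hA hAS => by
    simpa using (h A hA).trans (measure_mono_null hAS hν).le
  have hac : q ≪ᵥ ρ.toENNRealVectorMeasure := by
    refine VectorMeasure.AbsolutelyContinuous.mk fun A hA h0 => hq0 A hA fun x hx => ?_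
    rw [Measure.toENNRealVectorMeasure_apply_measurable hA] at h0
    simpa [S] using measure_mono_null (singleton_subset_iff.2 hx) h0
  have hv0 : ∀ᵐ x ∂ρ.restrict Sᶜ, velocity ρ q x = 0 := by
    refine (integrable_velocity ρ q).restrict.ae_eq_zero_of_forall_setIntegral_eq_zero
      fun A hA _ => ?_
    rw [Measure.restrict_restrict hA, setIntegral_velocity hac (hA.inter hS.measurableSet.compl)]
    exact hq0 _ (hA.inter hS.measurableSet.compl) inter_subset_right
  rw [instantCost, if_pos hac, atomicEnergy, if_pos]
  · have hterm : ∀ x, (ρ.withDensity (fun x => ‖velocity ρ q x‖ₑ ^ (1 / α))) {x} ^ α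
        ≤ atomWeight α ρ x * ν {x} := by
      intro x
      rw [withDensity_singleton]
      rcases eq_or_ne (ρ {x}) 0 with hx | hx
      · simp [hx, hα₀]
      · rw [rpow_mul_weight hα₀ hx (by finiteness)]
        unfold atomWeight
        gcongr
        -- At an atom `|v(x)| ρ {x}` is the norm of `q {x}`.
        refine le_trans (le_of_eq ?_) (h _ (measurableSet_singleton x))
        rw [← setIntegral_velocity hac (measurableSet_singleton x), integral_singleton,
          enorm_smul, Measure.real, mul_comm]
        simp [← ofReal_norm, abs_of_nonneg, ENNReal.ofReal_toReal]
    refine (ENNReal.tsum_le_tsum hterm).trans ?_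
    rw [ENNReal.tsum_eq_iSup_sum]
    refine iSup_le fun t => ?_
    rw [← lintegral_finset]
    exact setLIntegral_le_lintegral _ _
  · refine ⟨S, hS, ?_⟩
    rw [withDensity_apply _ hS.measurableSet.compl]
    refine (lintegral_eq_zero_iff' ?_).2 ?_
    · exact ((measurable_velocity ρ q).enorm.pow_const _).aemeasurable
    · filter_upwards [hv0] with x hx
      simp [hx, hα₀]

/-- The instantaneous cost is attained by the dominating measure `|v| ρ`. -/
lemma exists_dominating_lintegral_le {α : ℝ} (hα₀ : 0 < α) (ρ : Measure X)
    [IsProbabilityMeasure ρ] {q : VectorMeasure X (EuclideanSpace ℝ (Fin d))}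
    (h : instantCost α ρ q ≠ ⊤) :
    ∃ ν : Measure X, (∀ A, MeasurableSet A → ‖q A‖ₑ ≤ ν A) ∧
      ∫⁻ x, atomWeight α ρ x ∂ν ≤ instantCost α ρ q := by
  have hac : q ≪ᵥ ρ.toENNRealVectorMeasure := by
    by_contra hac
    exact h (by rw [instantCost, if_neg hac])
  rw [instantCost, if_pos hac] at h ⊢
  have hat : ∃ S : Set X, S.Countable ∧
      (ρ.withDensity fun x => ‖velocity ρ q x‖ₑ ^ (1 / α)) Sᶜ = 0 := by
    by_contra hat
    exact h (by rw [atomicEnergy, if_neg hat])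
  rw [atomicEnergy, if_pos hat]
  obtain ⟨S, hS, hS0⟩ := hat
  refine ⟨ρ.withDensity fun x => ‖velocity ρ q x‖ₑ, fun A hA => ?_, ?_⟩
  · rw [← setIntegral_velocity hac hA, withDensity_apply _ hA]
    exact enorm_integral_le_lintegral_enorm _
  set ν := ρ.withDensity fun x => ‖velocity ρ q x‖ₑ
  -- The functions `|v|` and `|v|^{1/α}` vanish at the same points, so `|v| ρ` is concentrated on
  -- the same countable set.
  have hνS : ν Sᶜ = 0 := by
    rw [withDensity_apply _ hS.measurableSet.compl] at hS0 ⊢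
    rw [lintegral_eq_zero_iff' ((measurable_velocity ρ q).enorm.pow_const _).aemeasurable] at hS0
    refine (lintegral_eq_zero_iff' (measurable_velocity ρ q).enorm.aemeasurable).2 ?_
    filter_upwards [hS0] with x hx
    simpa [hα₀, not_lt.2 hα₀.le] using hx
  have hsplit : ∫⁻ x, atomWeight α ρ x ∂ν = ∫⁻ x in S, atomWeight α ρ x ∂ν := by
    rw [← lintegral_add_compl _ hS.measurableSet, setLIntegral_measure_zero _ _ hνS, add_zero]
  rw [hsplit, lintegral_countable _ hS]
  calc ∑' x : S, atomWeight α ρ x * ν {(x : X)}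
      ≤ ∑' x : S, (ρ.withDensity fun x => ‖velocity ρ q x‖ₑ ^ (1 / α)) {(x : X)} ^ α := by
        refine ENNReal.tsum_le_tsum fun x => ?_
        rw [withDensity_singleton, withDensity_singleton]
        rcases eq_or_ne (ρ {(x : X)}) 0 with hx | hx
        · simp [hx]
        · rw [rpow_mul_weight hα₀ hx (by finiteness)]
          rfl
    _ ≤ _ := ENNReal.tsum_comp_le_tsum_of_injective Subtype.val_injective _

/-- Since the weight is at least 1, the dominating measure attaining the cost has mass at most the
cost. This is the source of compactness. -/
lemma variation_le_instantCost {α : ℝ} (hα₀ : 0 < α) (hα₁ : α < 1) (ρ : Measure X)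
    [IsProbabilityMeasure ρ] (q : VectorMeasure X (EuclideanSpace ℝ (Fin d))) :
    q.variation univ ≤ instantCost α ρ q := by
  by_cases h : instantCost α ρ q = ⊤
  · rw [h]; exact le_top
  obtain ⟨ν, hν, hle⟩ := exists_dominating_lintegral_le hα₀ ρ h
  calc q.variation univ ≤ ν univ := VectorMeasure.variation_le_of_forall_enorm_le hν univ
    _ = ∫⁻ _, 1 ∂ν := by simp
    _ ≤ ∫⁻ x, atomWeight α ρ x ∂ν := lintegral_mono fun x => one_le_atomWeight hα₁ ρ x
    _ ≤ _ := hle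

end AtomWeight

/-! ### Weak convergence of curves of probability measures. -/

section WeakConvergence

variable {d : ℕ} {Ω : Set (EuclideanSpace ℝ (Fin d))}

variable (Ω) in
/-- The restrictions to `Ω` of smooth functions. -/
def smoothSubalgebra : Subalgebra ℝ C(Ω, ℝ) where
  carrier := {f | ∃ ψ : EuclideanSpace ℝ (Fin d) → ℝ, ContDiff ℝ ∞ ψ ∧ ∀ x : Ω, f x = ψ x}
  mul_mem' := by
    rintro f g ⟨ψ, hψ, hf⟩ ⟨χ, hχ, hg⟩
    exact ⟨fun x => ψ x * χ x, hψ.mul hχ, fun x => by simp [hf, hg]⟩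
  add_mem' := by
    rintro f g ⟨ψ, hψ, hf⟩ ⟨χ, hχ, hg⟩
    exact ⟨fun x => ψ x + χ x, hψ.add hχ, fun x => by simp [hf, hg]⟩
  algebraMap_mem' r := ⟨fun _ => r, contDiff_const, fun x => by simp⟩

/-- Stone–Weierstrass: the coordinate functions already separate points. -/
lemma dense_smoothSubalgebra [CompactSpace Ω] :
    Dense (smoothSubalgebra Ω : Set C(Ω, ℝ)) := by
  have h := ContinuousMap.subalgebra_topologicalClosure_eq_top_of_separatesPoints
    (smoothSubalgebra Ω) (fun x y hxy => by
      obtain ⟨i, hi⟩ : ∃ i, (x : EuclideanSpace ℝ (Fin d)) i ≠ (y : EuclideanSpace ℝ (Fin d)) i := by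
        by_contra hcon
        push Not at hcon
        exact hxy (Subtype.ext (PiLp.ext hcon))
      refine ⟨_, ⟨⟨fun z => (z : EuclideanSpace ℝ (Fin d)) i, by fun_prop⟩,
        ⟨fun z => z i, (EuclideanSpace.proj i :
          EuclideanSpace ℝ (Fin d) →L[ℝ] ℝ).contDiff, fun _ => rfl⟩, rfl⟩, hi⟩)
  rw [dense_iff_closure_eq, ← Subalgebra.topologicalClosure_coe, h]
  rfl

lemma integrable_continuous {X : Type*} [TopologicalSpace X] [CompactSpace X]
    [TopologicalSpace.PseudoMetrizableSpace X]
    [MeasurableSpace X] [BorelSpace X] (μ : Measure X) [IsFiniteMeasure μ]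
    {F : Type*} [NormedAddCommGroup F] {f : X → F} (hf : Continuous f) : Integrable f μ :=
  hf.integrable_of_hasCompactSupport (HasCompactSupport.of_compactSpace f)

lemma abs_integral_sub_le_norm {X : Type*} [TopologicalSpace X] [CompactSpace X]
    [TopologicalSpace.PseudoMetrizableSpace X]
    [MeasurableSpace X] [BorelSpace X] (μ : ProbabilityMeasure X) (f g : C(X, ℝ)) :
    |∫ x, f x ∂(μ : Measure X) - ∫ x, g x ∂(μ : Measure X)| ≤ ‖f - g‖ := by
  rw [← integral_sub (integrable_continuous _ f.continuous) (integrable_continuous _ g.continuous)]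
  have := norm_integral_le_of_norm_le_const (μ := (μ : Measure X)) (f := fun x => f x - g x)
    (ae_of_all _ fun x => (f - g).norm_coe_le_norm x)
  simpa using this

lemma tendsto_probabilityMeasure_iff {X : Type*} [TopologicalSpace X] [CompactSpace X]
    [MeasurableSpace X] [OpensMeasurableSpace X] {ι : Type*} {l : Filter ι}
    {μs : ι → ProbabilityMeasure X} {μ : ProbabilityMeasure X} :
    Tendsto μs l (𝓝 μ) ↔ ∀ f : C(X, ℝ),
      Tendsto (fun i => ∫ x, f x ∂(μs i : Measure X)) l (𝓝 (∫ x, f x ∂(μ : Measure X))) := by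
  rw [ProbabilityMeasure.tendsto_iff_forall_integral_tendsto]
  exact (ContinuousMap.equivBoundedOfCompact X ℝ).symm.forall_congr_left

/-- Smooth functions determine weak convergence. -/
lemma tendsto_of_forall_contDiff [CompactSpace Ω] {ι : Type*} {l : Filter ι}
    {μs : ι → ProbabilityMeasure Ω} {μ : ProbabilityMeasure Ω}
    (h : ∀ ψ : EuclideanSpace ℝ (Fin d) → ℝ, ContDiff ℝ ∞ ψ →
      Tendsto (fun i => ∫ x : Ω, ψ x ∂(μs i : Measure Ω)) l (𝓝 (∫ x : Ω, ψ x ∂(μ : Measure Ω)))) :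
    Tendsto μs l (𝓝 μ) := by
  rw [tendsto_probabilityMeasure_iff]
  intro f
  rw [Metric.tendsto_nhds]
  intro ε hε
  obtain ⟨g, ⟨ψ, hψ, hg⟩, hfg⟩ := dense_smoothSubalgebra.exists_dist_lt f
    (show 0 < ε / 3 by positivity)
  rw [dist_eq_norm] at hfg
  have h1 := Metric.tendsto_nhds.1 (h ψ hψ) (ε / 3) (by positivity)
  filter_upwards [h1] with i hi
  simp_rw [← hg] at hi
  rw [Real.dist_eq] at hi ⊢
  have h2 := abs_le.1 (abs_integral_sub_le_norm (μs i) f g)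
  have h3 := abs_le.1 (abs_integral_sub_le_norm μ f g)
  have h4 := abs_lt.1 hi
  rw [abs_lt]
  constructor <;> linarith [h2.1, h2.2, h3.1, h3.2, h4.1, h4.2]

/-- Replacing the integrand costs at most the sup norm of the difference, uniformly over probability
measures; weak convergence handles the fixed integrand. -/
lemma continuous_integral_uncurry {X : Type*} [TopologicalSpace X] [CompactSpace X]
    [TopologicalSpace.PseudoMetrizableSpace X] [MeasurableSpace X] [BorelSpace X] :
    Continuous fun p : ProbabilityMeasure X × C(X, ℝ) => ∫ x, p.2 x ∂(p.1 : Measure X) := by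
  rw [continuous_iff_continuousAt]
  rintro ⟨μ, f⟩
  rw [ContinuousAt, Metric.tendsto_nhds]
  intro ε hε
  have h1 : ∀ᶠ p : ProbabilityMeasure X × C(X, ℝ) in 𝓝 (μ, f), ‖p.2 - f‖ < ε / 2 := by
    have : Tendsto (fun p : ProbabilityMeasure X × C(X, ℝ) => dist p.2 f) (𝓝 (μ, f)) (𝓝 0) := by
      have := (continuous_snd.dist (continuous_const (y := f))).tendsto
        ((μ, f) : ProbabilityMeasure X × C(X, ℝ))
      simpa using this
    simpa [dist_eq_norm] using this.eventually_lt_const (show 0 < ε / 2 by positivity)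
  have h2 : ∀ᶠ p : ProbabilityMeasure X × C(X, ℝ) in 𝓝 (μ, f),
      dist (∫ x, f x ∂(p.1 : Measure X)) (∫ x, f x ∂(μ : Measure X)) < ε / 2 :=
    Metric.tendsto_nhds.1 (tendsto_probabilityMeasure_iff.1 (continuous_fst.tendsto _) f) _
      (by positivity)
  filter_upwards [h1, h2] with p hp1 hp2
  calc dist (∫ x, p.2 x ∂(p.1 : Measure X)) (∫ x, f x ∂(μ : Measure X))
      ≤ dist (∫ x, p.2 x ∂(p.1 : Measure X)) (∫ x, f x ∂(p.1 : Measure X)) +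
        dist (∫ x, f x ∂(p.1 : Measure X)) (∫ x, f x ∂(μ : Measure X)) := dist_triangle _ _ _
    _ < ε / 2 + ε / 2 :=
        add_lt_add ((abs_integral_sub_le_norm p.1 p.2 f).trans_lt hp1) hp2
    _ = ε := by ring

/-- Integrals depending continuously on a parameter are jointly continuous in the measure and the
parameter. -/
lemma continuous_integral_param {X Z : Type*} [TopologicalSpace X] [CompactSpace X]
    [TopologicalSpace.PseudoMetrizableSpace X] [MeasurableSpace X] [BorelSpace X]
    [TopologicalSpace Z] {f : Z → X → ℝ} (hf : Continuous fun p : Z × X => f p.1 p.2) :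
    Continuous fun p : ProbabilityMeasure X × Z => ∫ x, f p.2 x ∂(p.1 : Measure X) := by
  let F : C(Z, C(X, ℝ)) := ContinuousMap.curry ⟨fun p : Z × X => f p.1 p.2, hf⟩
  exact continuous_integral_uncurry.comp
    (continuous_fst.prodMk (F.continuous.comp continuous_snd))

/-- Continuous convergence to a continuous limit is locally uniform, hence uniform on a compact
space. The filter is arbitrary so that ultrafilters are covered. -/
lemma tendstoUniformly_of_continuousConvergence {ι Z : Type*} [TopologicalSpace Z] [CompactSpace Z]
    {l : Filter ι} {F : ι → Z → ℝ} {f : Z → ℝ} (hf : Continuous f)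
    (h : ∀ z, Tendsto (fun p : ι × Z => F p.1 p.2) (l ×ˢ 𝓝 z) (𝓝 (f z))) :
    TendstoUniformly F f l := by
  rw [← tendstoLocallyUniformly_iff_tendstoUniformly_of_compactSpace,
    tendstoLocallyUniformly_iff_forall_tendsto]
  intro z
  have h1 : Tendsto (fun p : ι × Z => (f p.2, F p.1 p.2)) (l ×ˢ 𝓝 z) (𝓝 (f z) ×ˢ 𝓝 (f z)) :=
    ((hf.tendsto z).comp tendsto_snd).prodMk (h z)
  exact h1.mono_right (nhds_prod_eq.symm.le.trans (nhds_le_uniformity (f z)))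

/-- A pointwise convergent family of curves of measures that is equi-Lipschitz against each smooth
function converges continuously. -/
lemma tendsto_prod_of_equiLipschitz [CompactSpace Ω] {ι : Type*} {l : Filter ι}
    {ρs : ι → I → ProbabilityMeasure Ω} {ρ : I → ProbabilityMeasure Ω}
    (hL : ∀ ψ : EuclideanSpace ℝ (Fin d) → ℝ, ContDiff ℝ ∞ ψ → ∃ L : ℝ, ∀ i s t,
      |∫ x : Ω, ψ x ∂(ρs i s : Measure Ω) - ∫ x : Ω, ψ x ∂(ρs i t : Measure Ω)| ≤ L * dist s t)
    (hlim : ∀ t, Tendsto (fun i => ρs i t) l (𝓝 (ρ t))) (t : I) :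
    Tendsto (fun p : ι × I => ρs p.1 p.2) (l ×ˢ 𝓝 t) (𝓝 (ρ t)) := by
  refine tendsto_of_forall_contDiff fun ψ hψ => ?_
  obtain ⟨L, hL⟩ := hL ψ hψ
  let f : C(Ω, ℝ) := ⟨fun x => ψ x, hψ.continuous.comp continuous_subtype_val⟩
  have h1 : Tendsto (fun p : ι × I => ∫ x : Ω, ψ x ∂(ρs p.1 t : Measure Ω)) (l ×ˢ 𝓝 t)
      (𝓝 (∫ x : Ω, ψ x ∂(ρ t : Measure Ω))) :=
    (tendsto_probabilityMeasure_iff.1 (hlim t) f).comp tendsto_fst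
  have h2 : Tendsto (fun p : ι × I => ∫ x : Ω, ψ x ∂(ρs p.1 p.2 : Measure Ω) -
      ∫ x : Ω, ψ x ∂(ρs p.1 t : Measure Ω)) (l ×ˢ 𝓝 t) (𝓝 0) := by
    refine squeeze_zero_norm (fun p => hL p.1 p.2 t) ?_
    have : Tendsto (fun s : I => L * dist s t) (𝓝 t) (𝓝 (L * dist t t)) :=
      (continuous_const.mul (continuous_id.dist continuous_const)).tendsto t
    rw [dist_self, mul_zero] at this
    exact this.comp tendsto_snd
  simpa using h2.add h1

lemma lipschitz_of_tendsto [CompactSpace Ω] {ι : Type*} {l : Filter ι} [l.NeBot]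
    {ρs : ι → I → ProbabilityMeasure Ω} {ρ : I → ProbabilityMeasure Ω}
    {ψ : EuclideanSpace ℝ (Fin d) → ℝ} (hψ : Continuous ψ) {L : ℝ} (hL : ∀ i s t,
      |∫ x : Ω, ψ x ∂(ρs i s : Measure Ω) - ∫ x : Ω, ψ x ∂(ρs i t : Measure Ω)| ≤ L * dist s t)
    (hlim : ∀ t, Tendsto (fun i => ρs i t) l (𝓝 (ρ t))) (s t : I) :
    |∫ x : Ω, ψ x ∂(ρ s : Measure Ω) - ∫ x : Ω, ψ x ∂(ρ t : Measure Ω)| ≤ L * dist s t := by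
  let f : C(Ω, ℝ) := ⟨fun x => ψ x, hψ.comp continuous_subtype_val⟩
  have h := fun t => tendsto_probabilityMeasure_iff.1 (hlim t) f
  exact le_of_tendsto ((h s).sub (h t)).abs (Eventually.of_forall fun i => hL i s t)

lemma continuous_of_equiLipschitz [CompactSpace Ω] {ρ : I → ProbabilityMeasure Ω}
    (hL : ∀ ψ : EuclideanSpace ℝ (Fin d) → ℝ, ContDiff ℝ ∞ ψ → ∃ L : ℝ, ∀ s t,
      |∫ x : Ω, ψ x ∂(ρ s : Measure Ω) - ∫ x : Ω, ψ x ∂(ρ t : Measure Ω)| ≤ L * dist s t) :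
    Continuous ρ := by
  rw [continuous_iff_continuousAt]
  intro t
  -- A single curve is a family indexed by one point, for which convergence along `pure () ×ˢ 𝓝 t`
  -- is continuity at `t`.
  have h := tendsto_prod_of_equiLipschitz (l := (pure () : Filter Unit)) (ρs := fun _ => ρ)
    (ρ := ρ) (fun ψ hψ => by simpa using hL ψ hψ) (fun t => tendsto_const_nhds) t
  exact h.comp (tendsto_const_nhds (x := ()) |>.prodMk tendsto_id |>.mono_right (by simp))

end WeakConvergence

/-! ### Continuous approximation of the weight from below. -/

section SmoothedWeight

variable {X : Type*} [MetricSpace X] [CompactSpace X] [MeasurableSpace X] [BorelSpace X]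

/-- A continuous approximation of `ρ({x})`. -/
def smoothedAtom (k : ℕ) (ρ : ProbabilityMeasure X) (x : X) : ℝ :=
  ∫ y, Real.exp (-(k * dist x y)) ∂(ρ : Measure X)

/-- The kernel `exp (-k dist x y)` is continuous, positive, equal to 1 at `y = x`, and tends to the
indicator of `{x}`. Thus the smoothed atom is positive, lies above `ρ {x}` and converges to it; the
negative power `α - 1` reverses the inequality. -/
lemma continuous_smoothedAtom (k : ℕ) :
    Continuous fun p : ProbabilityMeasure X × X => smoothedAtom k p.1 p.2 :=
  continuous_integral_param (f := fun x y => Real.exp (-(k * dist x y))) (by fun_prop)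

lemma smoothedAtom_pos (k : ℕ) (ρ : ProbabilityMeasure X) (x : X) : 0 < smoothedAtom k ρ x := by
  refine integral_exp_pos (integrable_continuous _ (by fun_prop))

lemma smoothedAtom_ge (k : ℕ) (ρ : ProbabilityMeasure X) (x : X) :
    (ρ : Measure X) {x} ≤ ENNReal.ofReal (smoothedAtom k ρ x) := by
  unfold smoothedAtom
  rw [ofReal_integral_eq_lintegral_ofReal (integrable_continuous _ (by fun_prop))
    (ae_of_all _ fun _ => (Real.exp_pos _).le)]
  calc (ρ : Measure X) {x} = ∫⁻ y in {x}, 1 ∂(ρ : Measure X) := by simp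
    _ = ∫⁻ y in {x}, ENNReal.ofReal (Real.exp (-(k * dist x y))) ∂(ρ : Measure X) := by
        rw [lintegral_singleton, lintegral_singleton]; simp
    _ ≤ _ := setLIntegral_le_lintegral _ _

lemma tendsto_smoothedAtom (ρ : ProbabilityMeasure X) (x : X) :
    Tendsto (fun k => ENNReal.ofReal (smoothedAtom k ρ x)) atTop (𝓝 ((ρ : Measure X) {x})) := by
  have h : Tendsto (fun k => smoothedAtom k ρ x) atTop
      (𝓝 (∫ y, ({x} : Set X).indicator (fun _ => (1 : ℝ)) y ∂(ρ : Measure X))) := by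
    refine tendsto_integral_of_dominated_convergence (fun _ => 1)
      (fun k => (by fun_prop : Continuous _).aestronglyMeasurable)
      (integrable_const _) (fun k => ae_of_all _ fun y => ?_) (ae_of_all _ fun y => ?_)
    · rw [Real.norm_eq_abs, Real.abs_exp, Real.exp_le_one_iff]
      have : 0 ≤ (k : ℝ) * dist x y := by positivity
      linarith
    · by_cases hxy : y = x
      · subst hxy; simp
      · have hpos : 0 < dist x y := dist_pos.2 (Ne.symm hxy)
        simp only [mem_singleton_iff, hxy, not_false_eq_true, indicator_of_notMem]
        exact Real.tendsto_exp_neg_atTop_nhds_zero.comp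
          (tendsto_natCast_atTop_atTop.atTop_mul_const hpos)
  rw [integral_indicator (measurableSet_singleton x)] at h
  have h' := ENNReal.tendsto_ofReal h
  simpa [Measure.real] using h'

/-- A continuous approximation from below of `atomWeight α ρ x`. -/
def smoothedWeight (α : ℝ) (k : ℕ) (ρ : ProbabilityMeasure X) (x : X) : ℝ :=
  smoothedAtom k ρ x ^ (α - 1)

lemma continuous_smoothedWeight (α : ℝ) (k : ℕ) :
    Continuous fun p : ProbabilityMeasure X × X => smoothedWeight α k p.1 p.2 :=
  (continuous_smoothedAtom k).rpow_const fun p => Or.inl (smoothedAtom_pos k p.1 p.2).ne'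

lemma ofReal_smoothedWeight (α : ℝ) (k : ℕ) (ρ : ProbabilityMeasure X) (x : X) :
    ENNReal.ofReal (smoothedWeight α k ρ x) = ENNReal.ofReal (smoothedAtom k ρ x) ^ (α - 1) :=
  (ENNReal.ofReal_rpow_of_pos (smoothedAtom_pos k ρ x)).symm

lemma ofReal_smoothedWeight_le {α : ℝ} (hα₁ : α < 1) (k : ℕ) (ρ : ProbabilityMeasure X) (x : X) :
    ENNReal.ofReal (smoothedWeight α k ρ x) ≤ atomWeight α (ρ : Measure X) x := by
  rw [ofReal_smoothedWeight, atomWeight, ← neg_sub, ENNReal.rpow_neg, ENNReal.rpow_neg,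
    ENNReal.inv_le_inv]
  exact ENNReal.rpow_le_rpow (smoothedAtom_ge k ρ x) (by linarith)

lemma tendsto_smoothedWeight (α : ℝ) (ρ : ProbabilityMeasure X) (x : X) :
    Tendsto (fun k => ENNReal.ofReal (smoothedWeight α k ρ x)) atTop
      (𝓝 (atomWeight α (ρ : Measure X) x)) := by
  simp_rw [ofReal_smoothedWeight]
  exact (ENNReal.continuous_rpow_const.tendsto _).comp (tendsto_smoothedAtom ρ x)

end SmoothedWeight

/-! ### Normalizing the time variable. -/

section TimeChange

/-- The indicators of `Iic s` converge to that of `Iic t` except at the point `t`, which is null;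
dominated convergence concludes. -/
lemma continuous_measureReal_Iic (μ : Measure I) [IsFiniteMeasure μ]
    (h0 : ∀ t, μ {t} = 0) : Continuous fun t : I => μ.real (Iic t) := by
  have h : (fun t : I => μ.real (Iic t)) =
      fun t => ∫ x, (Iic t).indicator (fun _ => (1 : ℝ)) x ∂μ := by
    ext t; rw [integral_indicator measurableSet_Iic]; simp
  rw [h, continuous_iff_continuousAt]
  intro t
  refine tendsto_integral_filter_of_dominated_convergence (fun _ => 1)
    (Eventually.of_forall fun s =>
      (aestronglyMeasurable_const).indicator measurableSet_Iic)
    (Eventually.of_forall fun s => ae_of_all _ fun x => ?_) (integrable_const _) ?_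
  · by_cases hx : x ∈ Iic s <;> simp [hx]
  · have : ∀ᵐ x ∂μ, x ≠ t := by
      rw [ae_iff]; simpa using h0 t
    filter_upwards [this] with x hx
    refine tendsto_const_nhds.congr' ?_
    rcases lt_or_gt_of_ne hx with hx | hx
    · filter_upwards [lt_mem_nhds hx] with s hs
      simp [hx.le, hs.le]
    · filter_upwards [gt_mem_nhds hx] with s hs
      simp [hx, hs]

/-- A change of the time variable which sends `G + 1` to a constant. -/
lemma exists_timeChange {G : I → ℝ≥0∞} (hfin : ∫⁻ t, G t ≠ ⊤) :
    ∃ τ : I ≃o I, (volume.withDensity fun t => G t + 1).map τ =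
      (∫⁻ t, G t + 1) • (volume : Measure I) := by
  set μ := (volume : Measure I).withDensity fun t => G t + 1
  set c := ∫⁻ t, G t + 1
  have hμc : μ univ = c := by simp [μ, c]
  have hc : c = (∫⁻ t, G t) + 1 := by
    simp only [c]; rw [lintegral_add_right _ measurable_const]; simp
  have hctop : c ≠ ⊤ := by rw [hc]; finiteness
  have hc0 : c ≠ 0 := by rw [hc]; simp
  have : IsFiniteMeasure μ := ⟨by rw [hμc]; exact hctop.lt_top⟩
  -- The summand 1 makes `μ` dominate Lebesgue measure, so its distribution function increases
  -- strictly even where `G` vanishes.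
  have hvol : (volume : Measure I) ≤ μ := by
    refine Measure.le_iff.2 fun s hs => ?_
    rw [withDensity_apply _ hs]
    calc volume s = ∫⁻ _ in s, 1 := by simp
      _ ≤ _ := lintegral_mono fun t => le_add_self
  have h0 : ∀ t, μ {t} = 0 := fun t =>
    withDensity_absolutelyContinuous _ _ (measure_singleton t)
  have hcont := continuous_measureReal_Iic μ h0
  have hcr : 0 < c.toReal := ENNReal.toReal_pos hc0 hctop
  have hle : ∀ t, μ.real (Iic t) ≤ c.toReal := fun t => by
    rw [← hμc]; exact measureReal_mono (subset_univ _)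
  -- The normalized distribution function of `μ` pushes `μ` to a multiple of Lebesgue measure.
  let F : I → I := fun t => ⟨μ.real (Iic t) / c.toReal, by positivity, (div_le_one hcr).2 (hle t)⟩
  have hFc : Continuous F := (hcont.div_const _).subtype_mk _
  have hFm : StrictMono F := by
    intro s t hst
    refine Subtype.mk_lt_mk.2 (div_lt_div_of_pos_right ?_ hcr)
    have h1 : μ.real (Iic t) = μ.real (Iic s) + μ.real (Ioc s t) := by
      rw [← Iic_union_Ioc_eq_Iic hst.le, measureReal_union _ measurableSet_Ioc]
      exact Set.disjoint_left.2 fun x hx hx' => not_lt.2 hx hx'.1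
    have h2 : 0 < μ.real (Ioc s t) := by
      refine ENNReal.toReal_pos (fun h => ?_) (by finiteness)
      have := (hvol (Ioc s t)).trans h.le
      rw [unitInterval.volume_Ioc] at this
      simp only [nonpos_iff_eq_zero, ENNReal.ofReal_eq_zero] at this
      have : (s : ℝ) < t := hst
      linarith
    linarith
  have hF0 : F 0 = 0 := by
    refine Subtype.ext ?_
    have : (Iic (0 : I)) = {0} := by ext x; simp
    simp [F, this, Measure.real, h0]
  have hF1 : F 1 = 1 := by
    refine Subtype.ext ?_
    have : (Iic (1 : I)) = univ := by ext x; simp [unitInterval.le_one']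
    simp [F, this, Measure.real, hμc, hcr.ne']
  have hFs : Function.Surjective F := fun s =>
    mem_range_of_exists_le_of_exists_ge hFc ⟨0, by rw [hF0]; exact s.2.1⟩
      ⟨1, by rw [hF1]; exact s.2.2⟩
  let τ : I ≃o I := hFm.orderIsoOfSurjective F hFs
  refine ⟨τ, ?_⟩
  have hτm : Measurable τ := τ.continuous.measurable
  refine Measure.ext_of_Iic _ _ fun s => ?_
  rw [Measure.map_apply hτm measurableSet_Iic, τ.preimage_Iic, Measure.smul_apply,
    unitInterval.volume_Iic, smul_eq_mul]
  have h1 : ((F (τ.symm s) : I) : ℝ) = s := by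
    have : τ (τ.symm s) = s := τ.apply_symm_apply s
    exact congrArg Subtype.val this
  have h2 : μ.real (Iic (τ.symm s)) = c.toReal * s := by
    rw [← h1]; simp only [F]; field_simp
  rw [← ofReal_measureReal, h2, ENNReal.ofReal_mul hcr.le, ENNReal.ofReal_toReal hctop]

end TimeChange

/-! ### From weak derivatives to primitives. -/

section WeakDerivative

lemma integral_unitInterval_comp_coe (g : ℝ → ℝ) :
    ∫ t : I, g (t : ℝ) = ∫ t in (0 : ℝ)..1, g t := by
  rw [unitInterval.measurePreserving_coe.integral_comp unitInterval.measurableEmbedding_coe,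
    intervalIntegral.integral_of_le zero_le_one, integral_Icc_eq_integral_Ioc]

lemma integral_unitInterval_deriv {ζ : ℝ → ℝ} (hζ : ContDiff ℝ ∞ ζ) :
    ∫ t : I, deriv ζ (t : ℝ) = ζ 1 - ζ 0 := by
  rw [integral_unitInterval_comp_coe]
  exact intervalIntegral.integral_deriv_eq_sub
    (fun x _ => (hζ.differentiable (by simp)).differentiableAt)
    ((hζ.continuous_deriv (by exact_mod_cast le_top)).intervalIntegrable _ _)

/-- A smooth step of width `1 / n` near `a`. -/
def smoothStep (a e : ℝ) (n : ℕ) (t : ℝ) : ℝ := Real.smoothTransition (n * (t - a) + e)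

lemma contDiff_smoothStep (a e : ℝ) (n : ℕ) : ContDiff ℝ ∞ (smoothStep a e n) :=
  Real.smoothTransition.contDiff.comp (by fun_prop)

lemma monotone_smoothStep (a e : ℝ) (n : ℕ) : Monotone (smoothStep a e n) := fun s t h =>
  Real.smoothTransition.monotone (by gcongr)

lemma smoothStep_eventuallyEq_zero {a e t : ℝ} (h : t < a) :
    ∀ᶠ n in atTop, smoothStep a e n t = 0 := by
  have h1 : Tendsto (fun n : ℕ => (n : ℝ) * (a - t)) atTop atTop :=
    tendsto_natCast_atTop_atTop.atTop_mul_const (sub_pos.2 h)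
  filter_upwards [h1.eventually_ge_atTop e] with n hn
  exact Real.smoothTransition.zero_of_nonpos (by linarith)

lemma smoothStep_eventuallyEq_one {a e t : ℝ} (h : a < t) :
    ∀ᶠ n in atTop, smoothStep a e n t = 1 := by
  have h1 : Tendsto (fun n : ℕ => (n : ℝ) * (t - a)) atTop atTop :=
    tendsto_natCast_atTop_atTop.atTop_mul_const (sub_pos.2 h)
  filter_upwards [h1.eventually_ge_atTop (1 - e)] with n hn
  exact Real.smoothTransition.one_of_one_le (by linarith)

lemma deriv_smoothStep_eventuallyEq_zero (a e : ℝ) {δ : ℝ} (hδ : 0 < δ) :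
    ∀ᶠ n in atTop, ∀ t, δ ≤ |t - a| → deriv (smoothStep a e n) t = 0 := by
  have h0 := smoothStep_eventuallyEq_zero (a := a) (e := e) (t := a - δ / 2) (by linarith)
  have h1 := smoothStep_eventuallyEq_one (a := a) (e := e) (t := a + δ / 2) (by linarith)
  filter_upwards [h0, h1] with n hn0 hn1 t ht
  rcases le_abs.1 ht with ht | ht
  · have : smoothStep a e n =ᶠ[𝓝 t] fun _ => 1 := by
      filter_upwards [lt_mem_nhds (show a + δ / 2 < t by linarith)] with s hs
      exact le_antisymm (Real.smoothTransition.le_one _) (hn1 ▸ monotone_smoothStep a e n hs.le)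
    rw [this.deriv_eq]; simp
  · have : smoothStep a e n =ᶠ[𝓝 t] fun _ => 0 := by
      filter_upwards [gt_mem_nhds (show t < a - δ / 2 by linarith)] with s hs
      exact le_antisymm (hn0 ▸ monotone_smoothStep a e n hs.le) (Real.smoothTransition.nonneg _)
    rw [this.deriv_eq]; simp

/-- The derivatives form an approximate identity at `a`. The two hypotheses say that the whole step
takes place inside `[0, 1]`, so the total mass is 1 even when `a` is an endpoint. -/
lemma tendsto_integral_deriv_smoothStep {m : I → ℝ} (hm : Continuous m) (a : I) {e : ℝ}
    (h0 : ∀ᶠ n in atTop, smoothStep a e n 0 = 0) (h1 : ∀ᶠ n in atTop, smoothStep a e n 1 = 1) :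
    Tendsto (fun n => ∫ t : I, deriv (smoothStep a e n) t * m t) atTop (𝓝 (m a)) := by
  have hcont : ∀ n, Continuous fun t : I => deriv (smoothStep a e n) (t : ℝ) := fun n =>
    ((contDiff_smoothStep a e n).continuous_deriv (by exact_mod_cast le_top)).comp
      continuous_subtype_val
  have key := tendsto_setIntegral_peak_smul_of_integrableOn_of_tendsto (μ := (volume : Measure I))
    (s := univ) (t := univ) (l := atTop) (x₀ := a)
    (φ := fun n (t : I) => deriv (smoothStep a e n) (t : ℝ)) (g := m) (a := m a)
    MeasurableSet.univ MeasurableSet.univ subset_rfl univ_mem (by finiteness)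
    (Eventually.of_forall fun n t _ => (monotone_smoothStep a e n).deriv_nonneg)
    (fun u hu hau => ?_) ?_ (Eventually.of_forall fun n => (hcont n).aestronglyMeasurable)
    ((integrable_continuous _ hm).integrableOn) (by simpa using hm.tendsto a)
  · simpa using key
  · obtain ⟨δ, hδ, hball⟩ := Metric.isOpen_iff.1 hu a hau
    rw [Metric.tendstoUniformlyOn_iff]
    intro ε hε
    filter_upwards [deriv_smoothStep_eventuallyEq_zero a e hδ] with n hn t ht
    rw [hn t]
    · simpa using hε
    · by_contra hlt
      exact ht.2 (hball (by simpa [Subtype.dist_eq, Real.dist_eq] using hlt))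
  · refine tendsto_const_nhds.congr' ?_
    filter_upwards [h0, h1] with n hn0 hn1
    rw [Measure.restrict_univ, integral_unitInterval_deriv (contDiff_smoothStep a e n), hn0, hn1]
    simp

/-- A continuous function with an integrable weak derivative is its primitive. -/
lemma sub_eq_setIntegral_of_weakDeriv {m f : I → ℝ} (hm : Continuous m) (hf : Integrable f)
    (h : ∀ η : ℝ → ℝ, ContDiff ℝ ∞ η → η 0 = 0 → η 1 = 0 →
      ∫ t : I, (deriv η t * m t + η t * f t) = 0) {a b : I} (hab : a ≤ b) :
    m b - m a = ∫ t in Ioc a b, f t := by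
  rcases hab.eq_or_lt with rfl | hab
  · simp
  have hab' : (a : ℝ) < b := hab
  -- Offset 0 makes the step at `a` vanish for `t ≤ a`, and offset 1 makes the step at `b` equal 1
  -- for `t ≥ b`. Their difference `η n` therefore eventually vanishes at 0 and 1 even if `a = 0` or
  -- `b = 1`, and tends everywhere to the indicator of `Ioo a b`.
  have ha0 : ∀ᶠ n in atTop, smoothStep a 0 n 0 = 0 := Eventually.of_forall fun n =>
    Real.smoothTransition.zero_of_nonpos (by
      have := mul_nonneg (Nat.cast_nonneg (α := ℝ) n) a.2.1; linarith)
  have ha1 : ∀ᶠ n in atTop, smoothStep a 0 n 1 = 1 :=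
    smoothStep_eventuallyEq_one (hab'.trans_le b.2.2)
  have hb0 : ∀ᶠ n in atTop, smoothStep b 1 n 0 = 0 :=
    smoothStep_eventuallyEq_zero (a.2.1.trans_lt hab')
  have hb1 : ∀ᶠ n in atTop, smoothStep b 1 n 1 = 1 := Eventually.of_forall fun n =>
    Real.smoothTransition.one_of_one_le (by
      have := mul_nonneg (Nat.cast_nonneg (α := ℝ) n) (sub_nonneg.2 b.2.2); linarith)
  let η : ℕ → ℝ → ℝ := fun n t => smoothStep a 0 n t - smoothStep b 1 n t
  have hη : ∀ n, ContDiff ℝ ∞ (η n) := fun n =>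
    (contDiff_smoothStep _ _ n).sub (contDiff_smoothStep _ _ n)
  have hηle : ∀ n t, |η n t| ≤ 1 := fun n t => by
    rw [abs_le]
    constructor <;> simp only [η, smoothStep] <;>
    linarith [Real.smoothTransition.le_one (n * (t - a) + 0),
      Real.smoothTransition.le_one (n * (t - b) + 1),
      Real.smoothTransition.nonneg (n * (t - a) + 0),
      Real.smoothTransition.nonneg (n * (t - b) + 1)]
  have hcd : ∀ (c : I) e n, Integrable fun t : I => deriv (smoothStep c e n) t * m t :=
    fun c e n => integrable_continuous _
      ((((contDiff_smoothStep c e n).continuous_deriv (by exact_mod_cast le_top)).comp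
      continuous_subtype_val).mul hm)
  have hηf : ∀ n, Integrable fun t : I => η n t * f t := fun n =>
    hf.bdd_mul ((hη n).continuous.comp continuous_subtype_val).aestronglyMeasurable
      (ae_of_all _ fun t => hηle n t)
  have hlim1 : Tendsto (fun n => ∫ t : I, deriv (η n) t * m t) atTop (𝓝 (m a - m b)) := by
    refine ((tendsto_integral_deriv_smoothStep hm a ha0 ha1).sub
      (tendsto_integral_deriv_smoothStep hm b hb0 hb1)).congr fun n => ?_
    rw [← integral_sub (hcd a 0 n) (hcd b 1 n)]
    refine integral_congr_ae (ae_of_all _ fun t => ?_)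
    have : deriv (η n) t = deriv (smoothStep a 0 n) t - deriv (smoothStep b 1 n) t :=
      deriv_fun_sub ((contDiff_smoothStep _ _ n).differentiable (by simp)).differentiableAt
        ((contDiff_smoothStep _ _ n).differentiable (by simp)).differentiableAt
    simp only [this, sub_mul]
  have hlim2 : Tendsto (fun n => ∫ t : I, η n t * f t) atTop (𝓝 (∫ t in Ioo a b, f t)) := by
    rw [← integral_indicator measurableSet_Ioo]
    refine tendsto_integral_of_dominated_convergence (fun t => ‖f t‖)
      (fun n => (hηf n).aestronglyMeasurable) hf.norm
      (fun n => ae_of_all _ fun t => ?_) (ae_of_all _ fun t => ?_)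
    · rw [norm_mul]
      exact mul_le_of_le_one_left (norm_nonneg _) (hηle n t)
    · refine tendsto_const_nhds.congr' ?_
      have hstep : ∀ᶠ n in atTop, η n t = (Ioo a b).indicator (fun _ => (1 : ℝ)) t := by
        rcases le_or_gt t a with hta | hta
        · have hta' : (t : ℝ) ≤ a := hta
          filter_upwards [smoothStep_eventuallyEq_zero (e := 1) (hta'.trans_lt hab')] with n hn
          have : smoothStep a 0 n t = 0 := Real.smoothTransition.zero_of_nonpos (by
            have := mul_nonneg (Nat.cast_nonneg (α := ℝ) n) (sub_nonneg.2 hta'); linarith)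
          simp [η, hn, this, not_lt.2 hta]
        · have h1 := smoothStep_eventuallyEq_one (e := 0) (show (a : ℝ) < t from hta)
          rcases lt_or_ge t b with htb | htb
          · filter_upwards [h1, smoothStep_eventuallyEq_zero (e := 1)
              (show (t : ℝ) < b from htb)] with n hn1 hn2
            simp [η, hn1, hn2, hta, htb]
          · filter_upwards [h1] with n hn1
            have : smoothStep b 1 n t = 1 := Real.smoothTransition.one_of_one_le (by
              have := mul_nonneg (Nat.cast_nonneg (α := ℝ) n)
                (sub_nonneg.2 (show (b : ℝ) ≤ t from htb)); linarith)
            simp [η, hn1, this, not_lt.2 htb]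
      filter_upwards [hstep] with n hn
      rw [hn]
      by_cases ht : t ∈ Ioo a b <;> simp [ht]
  have hsum : ∀ᶠ n in atTop, (∫ t : I, deriv (η n) t * m t) + ∫ t : I, η n t * f t = 0 := by
    filter_upwards [ha0, ha1, hb0, hb1] with n h1 h2 h3 h4
    rw [← integral_add _ (hηf n)]
    · exact h (η n) (hη n) (by simp [η, h1, h3]) (by simp [η, h2, h4])
    · exact integrable_continuous _ ((((hη n).continuous_deriv (by exact_mod_cast le_top)).comp
        continuous_subtype_val).mul hm)
  have := tendsto_nhds_unique ((hlim1.add hlim2).congr' hsum) tendsto_const_nhds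
  rw [integral_Ioc_eq_integral_Ioo]
  linarith

end WeakDerivative

/-! ### Partial derivatives of test functions. -/

section Derivatives

variable {d : ℕ} {φ : ℝ × EuclideanSpace ℝ (Fin d) → ℝ}

lemma deriv_left_eq (hφ : ContDiff ℝ ∞ φ) (t : ℝ) (x : EuclideanSpace ℝ (Fin d)) :
    deriv (fun s => φ (s, x)) t = fderiv ℝ φ (t, x) (1, 0) := by
  have h1 : HasFDerivAt φ (fderiv ℝ φ (t, x)) (t, x) :=
    (hφ.differentiable (by simp)).differentiableAt.hasFDerivAt
  exact (h1.comp_hasDerivAt t ((hasDerivAt_id t).prodMk (hasDerivAt_const t x))).deriv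

lemma fderiv_right_eq (hφ : ContDiff ℝ ∞ φ) (t : ℝ) (x : EuclideanSpace ℝ (Fin d)) :
    fderiv ℝ (fun y => φ (t, y)) x =
      (fderiv ℝ φ (t, x)).comp (ContinuousLinearMap.inr ℝ ℝ (EuclideanSpace ℝ (Fin d))) := by
  have h1 : HasFDerivAt φ (fderiv ℝ φ (t, x)) (t, x) :=
    (hφ.differentiable (by simp)).differentiableAt.hasFDerivAt
  exact (h1.comp x (hasFDerivAt_prodMk_right t x)).fderiv

lemma continuous_deriv_left (hφ : ContDiff ℝ ∞ φ) :
    Continuous fun p : ℝ × EuclideanSpace ℝ (Fin d) => deriv (fun s => φ (s, p.2)) p.1 := by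
  simp_rw [deriv_left_eq hφ]
  exact (hφ.continuous_fderiv (by simp)).clm_apply continuous_const

lemma continuous_fderiv_right (hφ : ContDiff ℝ ∞ φ) :
    Continuous fun p : ℝ × EuclideanSpace ℝ (Fin d) => fderiv ℝ (fun y => φ (p.1, y)) p.2 := by
  simp_rw [fderiv_right_eq hφ]
  exact (hφ.continuous_fderiv (by simp)).clm_comp continuous_const

end Derivatives

/-- The integral of a function with values in the dual space against a vector measure. -/
abbrev pairing {X E : Type*} [MeasurableSpace X] [NormedAddCommGroup E] [NormedSpace ℝ E]
    (q : VectorMeasure X E) (f : X → E →L[ℝ] ℝ) : ℝ :=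
  ∫ᵛ x, f x ∂[ContinuousLinearMap.id ℝ (E →L[ℝ] ℝ); q]

/-! ### The continuity equation, integrated and under a change of time. -/

section Flux

variable {d : ℕ} {Ω : Set (EuclideanSpace ℝ (Fin d))} [CompactSpace Ω] [Nonempty Ω]
  {q : I → VectorMeasure Ω (EuclideanSpace ℝ (Fin d))}

lemma aestronglyMeasurable_riemannSum
    (hq : ∀ B : Set Ω, MeasurableSet B → AEMeasurable fun t => q t B) (π : SimpleFunc Ω Ω)
    {f : I → Ω → EuclideanSpace ℝ (Fin d) →L[ℝ] ℝ}
    (hf : Continuous fun p : I × Ω => f p.1 p.2) :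
    AEStronglyMeasurable fun t => riemannSum (q t) π (f t) := by
  unfold riemannSum
  refine Finset.aestronglyMeasurable_fun_sum _ fun y _ => ?_
  have h1 : Continuous fun t => f t y := hf.comp (continuous_id.prodMk continuous_const)
  exact (isBoundedBilinearMap_apply (𝕜 := ℝ)).continuous.comp_aestronglyMeasurable
    (h1.aestronglyMeasurable.prodMk (hq _ (π.measurableSet_fiber y)).aestronglyMeasurable)

lemma aestronglyMeasurable_pairing
    (hq : ∀ B : Set Ω, MeasurableSet B → AEMeasurable fun t => q t B)
    {f : I → Ω → EuclideanSpace ℝ (Fin d) →L[ℝ] ℝ}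
    (hf : Continuous fun p : I × Ω => f p.1 p.2) :
    AEStronglyMeasurable fun t => pairing (q t) (f t) :=
  aestronglyMeasurable_of_tendsto_ae atTop
    (fun n => aestronglyMeasurable_riemannSum hq (mesh Ω n) hf)
    (ae_of_all _ fun t => tendsto_riemannSum (q t)
      (hf.comp ((continuous_const (y := t)).prodMk continuous_id)))

lemma aemeasurable_massBound
    (hq : ∀ B : Set Ω, MeasurableSet B → AEMeasurable fun t => q t B) :
    AEMeasurable fun t => massBound (q t) := by
  unfold massBound partitionMass
  exact AEMeasurable.iSup fun n => Finset.aemeasurable_fun_sum _ fun y _ =>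
    (hq _ ((mesh Ω n).measurableSet_fiber y)).enorm

lemma lintegral_massBound_ne_top (hq : IsL1Flux q) : ∫⁻ t, massBound (q t) ≠ ⊤ :=
  ((lintegral_mono fun t => massBound_le_variation (q t)).trans_lt hq.2).ne

lemma massBound_ne_top (q : VectorMeasure Ω (EuclideanSpace ℝ (Fin d))) : massBound q ≠ ⊤ :=
  ((massBound_le_variation q).trans_lt (measure_lt_top _ _)).ne

lemma integrable_massBound (hq : IsL1Flux q) : Integrable fun t => (massBound (q t)).toReal :=
  integrable_toReal_of_lintegral_ne_top (aemeasurable_massBound hq.1)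
    (lintegral_massBound_ne_top hq)

lemma abs_pairing_le (q : VectorMeasure Ω (EuclideanSpace ℝ (Fin d)))
    {f : Ω → EuclideanSpace ℝ (Fin d) →L[ℝ] ℝ} (hf : Continuous f) {C : ℝ}
    (h : ∀ x, ‖f x‖ ≤ C) : |pairing q f| ≤ C * (massBound q).toReal := by
  have hC : 0 ≤ C := (norm_nonneg _).trans (h (Classical.arbitrary Ω))
  have h1 := enorm_integral_le_massBound q hf (C := ENNReal.ofReal C) fun x => by
    rw [← ofReal_norm]; exact ENNReal.ofReal_le_ofReal (h x)
  have h2 := ENNReal.toReal_mono (ENNReal.mul_ne_top ENNReal.ofReal_ne_top (massBound_ne_top q)) h1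
  rwa [ENNReal.toReal_mul, ENNReal.toReal_ofReal hC, toReal_enorm] at h2

lemma integrable_pairing (hq : IsL1Flux q) {f : I → Ω → EuclideanSpace ℝ (Fin d) →L[ℝ] ℝ}
    (hf : Continuous fun p : I × Ω => f p.1 p.2) :
    Integrable fun t => pairing (q t) (f t) := by
  obtain ⟨C, hC⟩ := isCompact_univ.exists_bound_of_continuousOn hf.continuousOn
  refine ((integrable_massBound hq).const_mul C).mono' (aestronglyMeasurable_pairing hq.1 hf)
    (ae_of_all _ fun t => abs_pairing_le (q t)
      (hf.comp ((continuous_const (y := t)).prodMk continuous_id)) fun x => hC (t, x) (mem_univ _))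

variable {p : Pair Ω}

lemma continuous_integral_curve {ρ : I → ProbabilityMeasure Ω} (hρ : Continuous ρ)
    {f : I → Ω → ℝ} (hf : Continuous fun p : I × Ω => f p.1 p.2) :
    Continuous fun t => ∫ x, f t x ∂(ρ t : Measure Ω) :=
  (continuous_integral_param hf).comp (hρ.prodMk continuous_id)

/-- The integrated form of the continuity equation. -/
lemma integral_sub_integral_eq (hq : IsL1Flux p.2) (hc : ContinuityEquation p)
    {ψ : EuclideanSpace ℝ (Fin d) → ℝ} (hψ : ContDiff ℝ ∞ ψ) {a b : I} (hab : a ≤ b) :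
    ∫ x : Ω, ψ x ∂(p.1 b : Measure Ω) - ∫ x : Ω, ψ x ∂(p.1 a : Measure Ω) =
      ∫ t in Ioc a b, pairing (p.2 t) fun x : Ω => fderiv ℝ ψ x := by
  have hDψ : Continuous fun x : Ω => fderiv ℝ ψ x :=
    (hψ.continuous_fderiv (by simp)).comp continuous_subtype_val
  refine sub_eq_setIntegral_of_weakDeriv (m := fun t => ∫ x : Ω, ψ x ∂(p.1 t : Measure Ω))
    (continuous_integral_curve p.1.continuous (f := fun _ x => ψ x)
      (hψ.continuous.comp (continuous_subtype_val.comp continuous_snd)))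
    (integrable_pairing hq (f := fun _ x => fderiv ℝ ψ x) (hDψ.comp continuous_snd))
    (fun η hη h0 h1 => ?_) hab
  -- Test functions in product form reduce the equation to a weak derivative in time.
  have := hc (fun z => η z.1 * ψ z.2)
    ((hη.comp contDiff_fst).mul (hψ.comp contDiff_snd)) (fun x _ => by simp [h0, h1])
  rw [← this]
  refine integral_congr_ae (ae_of_all _ fun t => ?_)
  have e1 : ∀ x, deriv (fun s : ℝ => η s * ψ x) t = deriv η t * ψ x := fun x =>
    deriv_mul_const_field _
  have e2 : ∀ x, fderiv ℝ (fun y => η t * ψ y) x = η t • fderiv ℝ ψ x := fun x =>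
    fderiv_const_mul (hψ.differentiable (by simp)).differentiableAt _
  simp only [e1, e2, integral_const_mul, VectorMeasure.integral_fun_smul, smul_eq_mul]

/-- A function whose increments are small compared with those of a fixed function is constant. -/
lemma eq_of_forall_small_increment {D V : I → ℝ}
    (h : ∀ ε > 0, ∃ δ > 0, ∀ a b : I, a ≤ b → (b : ℝ) - a ≤ δ → |D b - D a| ≤ ε * (V b - V a)) :
    D 1 = D 0 := by
  have key : ∀ ε > 0, |D 1 - D 0| ≤ ε * (V 1 - V 0) := by
    intro ε hε
    obtain ⟨δ, hδ, hD⟩ := h ε hε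
    obtain ⟨N, hN⟩ := exists_nat_one_div_lt hδ
    have hN1 : (0 : ℝ) < N + 1 := by positivity
    -- Both increments telescope over the uniform partition into `N + 1` intervals, each of length
    -- below `δ`.
    let u : ℕ → I := fun i => projIcc 0 1 zero_le_one ((i : ℝ) / (N + 1))
    have hu0 : u 0 = 0 := by
      simp only [u, Nat.cast_zero, zero_div]; exact projIcc_left _
    have hu1 : u (N + 1) = 1 := by
      have : ((N + 1 : ℕ) : ℝ) / (N + 1) = 1 := by push_cast; field_simp
      simp only [u, this]; exact projIcc_right _
    have hval : ∀ i ≤ N + 1, ((u i : I) : ℝ) = i / (N + 1) := fun i hi => by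
      have : (i : ℝ) / (N + 1) ∈ Icc (0 : ℝ) 1 :=
        ⟨by positivity, (div_le_one hN1).2 (by exact_mod_cast hi)⟩
      simp [u, projIcc_of_mem _ this]
    have hstep : ∀ i ∈ Finset.range (N + 1), |D (u (i + 1)) - D (u i)| ≤
        ε * (V (u (i + 1)) - V (u i)) := by
      intro i hi
      have hi' := Finset.mem_range.1 hi
      refine hD _ _ (monotone_projIcc _ (by gcongr; simp)) ?_
      rw [hval _ (by omega), hval _ (by omega)]
      have : ((i + 1 : ℕ) : ℝ) / (N + 1) - i / (N + 1) = 1 / (N + 1) := by push_cast; ring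
      rw [this]; exact hN.le
    calc |D 1 - D 0| = |∑ i ∈ Finset.range (N + 1), (D (u (i + 1)) - D (u i))| := by
          rw [Finset.sum_range_sub (fun i => D (u i)), hu0, hu1]
      _ ≤ ∑ i ∈ Finset.range (N + 1), |D (u (i + 1)) - D (u i)| := Finset.abs_sum_le_sum_abs _ _
      _ ≤ ∑ i ∈ Finset.range (N + 1), ε * (V (u (i + 1)) - V (u i)) := Finset.sum_le_sum hstep
      _ = ε * (V 1 - V 0) := by
          rw [← Finset.mul_sum, Finset.sum_range_sub (fun i => V (u i)), hu0, hu1]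
  have h0 : |D 1 - D 0| ≤ 0 := by
    have hlim : Tendsto (fun ε : ℝ => ε * (V 1 - V 0)) (𝓝[>] 0) (𝓝 0) := by
      have : Tendsto (fun ε : ℝ => ε * (V 1 - V 0)) (𝓝 0) (𝓝 (0 * (V 1 - V 0))) :=
        (continuous_id.mul continuous_const).tendsto 0
      rw [zero_mul] at this
      exact this.mono_left nhdsWithin_le_nhds
    exact ge_of_tendsto hlim (eventually_nhdsWithin_of_forall fun ε hε => key ε hε)
  linarith [abs_nonpos_iff.1 h0]

lemma setIntegral_Ioc_sub {f : I → ℝ} (hf : Integrable f) {a b : I} (hab : a ≤ b) :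
    (∫ t in Ioc 0 b, f t) - ∫ t in Ioc 0 a, f t = ∫ t in Ioc a b, f t := by
  rw [← Ioc_union_Ioc_eq_Ioc (show (0 : I) ≤ a from a.2.1) hab,
    setIntegral_union (Ioc_disjoint_Ioc_of_le le_rfl) measurableSet_Ioc hf.integrableOn
      hf.integrableOn]
  ring

lemma setIntegral_Ioc_zero_one (f : I → ℝ) : ∫ t in Ioc 0 1, f t = ∫ t, f t := by
  have : (Icc 0 1 : Set I) = univ := by ext x; simp [unitInterval.le_one']
  rw [← integral_Icc_eq_integral_Ioc, this, Measure.restrict_univ]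

lemma abs_setIntegral_Ioc_sub_le {A : I → ℝ} (hA : Continuous A) {a b : I} (hab : a ≤ b)
    {c ε : ℝ} (h : ∀ t ∈ Ioc a b, |A t - c| ≤ ε) :
    |(∫ t in Ioc a b, A t) - (b - a) * c| ≤ ε * (b - a) := by
  have hv : (volume : Measure I).real (Ioc a b) = b - a := by
    rw [Measure.real, unitInterval.volume_Ioc, ENNReal.toReal_ofReal (sub_nonneg.2 hab)]
  have h1 : (∫ t in Ioc a b, A t) - (b - a) * c = ∫ t in Ioc a b, (A t - c) := by
    rw [integral_sub (integrable_continuous _ hA).integrableOn (integrable_const _)]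
    simp [hv]
  rw [h1, ← hv]
  rw [← Real.norm_eq_abs]
  exact norm_setIntegral_le_of_norm_le_const (measure_lt_top _ _) h

/-- For each `x` the mean value theorem gives the increment as `b - a` times a time derivative at an
intermediate point, within `ε` of the one at `b`. -/
lemma abs_integral_increment_sub_le {φ : ℝ × EuclideanSpace ℝ (Fin d) → ℝ}
    (hφ : ContDiff ℝ ∞ φ) (μ : ProbabilityMeasure Ω) {a b : I} (hab : a ≤ b) {ε : ℝ}
    (h : ∀ s ∈ Icc a b, ∀ x : Ω, |deriv (fun r => φ (r, (x : EuclideanSpace ℝ (Fin d)))) s -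
      deriv (fun r => φ (r, (x : EuclideanSpace ℝ (Fin d)))) b| ≤ ε) :
    |(∫ x : Ω, φ (b, x) ∂(μ : Measure Ω)) - (∫ x : Ω, φ (a, x) ∂(μ : Measure Ω)) -
      (b - a) * ∫ x : Ω, deriv (fun r => φ (r, (x : EuclideanSpace ℝ (Fin d)))) b ∂(μ : Measure Ω)|
      ≤ ε * (b - a) := by
  have hφc : ∀ c : ℝ, Continuous fun x : Ω => φ (c, x) := fun c =>
    hφ.continuous.comp (continuous_const.prodMk continuous_subtype_val)
  have hdc : Continuous fun x : Ω => deriv (fun r => φ (r, (x : EuclideanSpace ℝ (Fin d)))) b :=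
    (continuous_deriv_left hφ).comp
      ((continuous_const (y := (b : ℝ))).prodMk continuous_subtype_val)
  have i1 := integrable_continuous (μ : Measure Ω) (hφc b)
  have i2 := integrable_continuous (μ : Measure Ω) (hφc a)
  have i3 : Integrable (fun x : Ω => φ (b, x) - φ (a, x)) (μ : Measure Ω) := i1.sub i2
  rw [← integral_sub i1 i2, ← integral_const_mul,
    ← integral_sub i3 ((integrable_continuous (μ : Measure Ω) hdc).const_mul _)]
  have hb : ∀ x : Ω, ‖φ (b, x) - φ (a, x) -
      (b - a) * deriv (fun r => φ (r, (x : EuclideanSpace ℝ (Fin d)))) b‖ ≤ ε * (b - a) := by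
    intro x
    have hdiff : Differentiable ℝ fun r => φ (r, (x : EuclideanSpace ℝ (Fin d))) :=
      (hφ.comp (contDiff_id.prodMk contDiff_const)).differentiable (by simp)
    rcases hab.eq_or_lt with rfl | hlt
    · simp
    obtain ⟨ξ, hξ, hslope⟩ := exists_deriv_eq_slope (fun r => φ (r, (x : EuclideanSpace ℝ (Fin d))))
      (show (a : ℝ) < b from hlt) hdiff.continuous.continuousOn hdiff.differentiableOn
    have hba : (0 : ℝ) < b - a := sub_pos.2 hlt
    rw [eq_div_iff hba.ne'] at hslope
    have hξI : ξ ∈ Icc (0 : ℝ) 1 := ⟨a.2.1.trans hξ.1.le, hξ.2.le.trans b.2.2⟩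
    have := h ⟨ξ, hξI⟩ ⟨hξ.1.le, hξ.2.le⟩ x
    rw [← hslope, mul_comm, ← mul_sub, norm_mul, Real.norm_of_nonneg hba.le, Real.norm_eq_abs,
      mul_comm]
    gcongr
  have := norm_integral_le_of_norm_le_const (μ := (μ : Measure Ω)) (ae_of_all _ hb)
  simpa using this

/-- The continuity equation after a change of the time variable. -/
lemma continuityEquation_timeChange (hq : IsL1Flux p.2) (hc : ContinuityEquation p) (τ : I ≃o I)
    {φ : ℝ × EuclideanSpace ℝ (Fin d) → ℝ} (hφ : ContDiff ℝ ∞ φ)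
    (h0 : ∀ x ∈ Ω, φ (0, x) = 0 ∧ φ (1, x) = 0) :
    (∫ s : I, ∫ x : Ω, deriv (fun r => φ (r, (x : EuclideanSpace ℝ (Fin d)))) s
        ∂(p.1 (τ.symm s) : Measure Ω)) +
      ∫ t : I, pairing (p.2 t) (fun x : Ω => fderiv ℝ (fun y => φ (τ t, y)) x) = 0 := by
  set ρ : I → ProbabilityMeasure Ω := fun s => p.1 (τ.symm s)
  have hρ : Continuous ρ := p.1.continuous.comp τ.symm.continuous
  have hdφ : Continuous fun z : I × Ω =>
      deriv (fun r => φ (r, (z.2 : EuclideanSpace ℝ (Fin d)))) z.1 :=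
    (continuous_deriv_left hφ).comp ((continuous_subtype_val.comp continuous_fst).prodMk
      (continuous_subtype_val.comp continuous_snd))
  have hDφ : Continuous fun z : I × Ω => fderiv ℝ (fun y => φ ((z.1 : ℝ), y)) z.2 :=
    (continuous_fderiv_right hφ).comp ((continuous_subtype_val.comp continuous_fst).prodMk
      (continuous_subtype_val.comp continuous_snd))
  have hDφx : ∀ s : I, Continuous fun x : Ω => fderiv ℝ (fun y => φ ((s : ℝ), y)) x := fun s =>
    hDφ.comp ((continuous_const (y := s)).prodMk continuous_id)
  set A : I → ℝ := fun s => ∫ x : Ω, deriv (fun r => φ (r, (x : EuclideanSpace ℝ (Fin d)))) s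
    ∂(ρ s : Measure Ω)
  have hA : Continuous A := continuous_integral_curve hρ hdφ
  set f : I → ℝ := fun t => pairing (p.2 t) fun x : Ω => fderiv ℝ (fun y => φ (τ t, y)) x
  have hf : Integrable f := integrable_pairing hq
    (hDφ.comp ((τ.continuous.comp continuous_fst).prodMk continuous_snd))
  set g : I → ℝ := fun t => (massBound (p.2 t)).toReal
  have hg : Integrable g := integrable_massBound hq
  -- As `τ` is merely a homeomorphism, `φ (τ t, x)` need not be a smooth test function. Instead `D`
  -- is the defect in the integrated identity and `V` measures the admissible error: `2 s` for the
  -- two time terms, and the flux mass for the third.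
  let D : I → ℝ := fun s => (∫ x : Ω, φ (s, x) ∂(ρ s : Measure Ω)) - (∫ r in Ioc 0 s, A r) -
    ∫ t in Ioc 0 (τ.symm s), f t
  let V : I → ℝ := fun s => 2 * s + ∫ t in Ioc 0 (τ.symm s), g t
  have hτ0 : τ.symm 0 = 0 := τ.symm.map_bot
  have hτ1 : τ.symm 1 = 1 := τ.symm.map_top
  have hD : D 1 = D 0 := by
    refine eq_of_forall_small_increment (V := V) fun ε hε => ?_
    obtain ⟨δ₁, hδ₁, h1⟩ := Metric.uniformContinuous_iff.1
      (CompactSpace.uniformContinuous_of_continuous hdφ) ε hε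
    obtain ⟨δ₂, hδ₂, h2⟩ := Metric.uniformContinuous_iff.1
      (CompactSpace.uniformContinuous_of_continuous hDφ) ε hε
    obtain ⟨δ₃, hδ₃, h3⟩ := Metric.uniformContinuous_iff.1
      (CompactSpace.uniformContinuous_of_continuous hA) ε hε
    refine ⟨min δ₁ (min δ₂ δ₃) / 2, by positivity, fun a b hab hδ => ?_⟩
    have hm1 := min_le_left δ₁ (min δ₂ δ₃)
    have hm2 := (min_le_right δ₁ (min δ₂ δ₃)).trans (min_le_left _ _)
    have hm3 := (min_le_right δ₁ (min δ₂ δ₃)).trans (min_le_right _ _)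
    have hmpos : 0 < min δ₁ (min δ₂ δ₃) := by positivity
    have hdist : ∀ s ∈ Icc a b, |(s : ℝ) - b| < min δ₁ (min δ₂ δ₃) ∧
        |(a : ℝ) - s| < min δ₁ (min δ₂ δ₃) := by
      intro s hs
      have hs1 : (a : ℝ) ≤ s := hs.1
      have hs2 : (s : ℝ) ≤ b := hs.2
      constructor <;> rw [abs_lt] <;> constructor <;> linarith
    have hab' : τ.symm a ≤ τ.symm b := τ.symm.monotone hab
    -- The increment of `∫ φ dρ` is split at `∫ φ(a, ·) dρ_b`: first the function moves with the
    -- measure frozen (`e1`, with `e2` for its time integral), then the measure moves with the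
    -- function frozen at time `a` (`e3`).
    have e1 := abs_integral_increment_sub_le hφ (ρ b) hab (ε := ε) fun s hs x => by
      have := h1 (a := (s, x)) (b := (b, x)) (by
        rw [Prod.dist_eq, dist_self, max_eq_left dist_nonneg, Subtype.dist_eq, Real.dist_eq]
        exact (hdist s hs).1.trans_le hm1)
      exact this.le
    have e2 := abs_setIntegral_Ioc_sub_le hA hab (c := A b) (ε := ε) fun s hs => by
      have := h3 (a := s) (b := b) (by
        rw [Subtype.dist_eq, Real.dist_eq]
        exact (hdist s ⟨hs.1.le, hs.2⟩).1.trans_le hm3)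
      exact this.le
    have e3 : |(∫ x : Ω, φ (a, x) ∂(ρ b : Measure Ω)) - (∫ x : Ω, φ (a, x) ∂(ρ a : Measure Ω)) -
        ∫ t in Ioc (τ.symm a) (τ.symm b), f t| ≤ ε * ∫ t in Ioc (τ.symm a) (τ.symm b), g t := by
      have hψ : ContDiff ℝ ∞ fun y => φ ((a : ℝ), y) := hφ.comp (contDiff_const.prodMk contDiff_id)
      have hpa : Integrable fun t => pairing (p.2 t) fun x : Ω => fderiv ℝ (fun y => φ (a, y)) x :=
        integrable_pairing hq 
          (f := fun _ x => fderiv ℝ (fun y => φ (a, y)) (x : EuclideanSpace ℝ (Fin d)))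
          ((hDφx a).comp continuous_snd)
      rw [integral_sub_integral_eq hq hc hψ hab',
        ← integral_sub hpa.integrableOn hf.integrableOn, ← integral_const_mul]
      rw [← Real.norm_eq_abs]
      refine norm_integral_le_of_norm_le (hg.integrableOn.const_mul ε) ?_
      refine (ae_restrict_iff' measurableSet_Ioc).2 (ae_of_all _ fun t ht => ?_)
      have hτt : τ t ∈ Icc a b := ⟨(τ.symm_apply_le.1 ht.1.le), (τ.le_symm_apply.1 ht.2)⟩
      have hsub : (pairing (p.2 t) fun x : Ω => fderiv ℝ (fun y => φ (a, y)) x) - f t =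
          pairing (p.2 t) fun x : Ω => fderiv ℝ (fun y => φ (a, y)) x -
            fderiv ℝ (fun y => φ (τ t, y)) x :=
        (VectorMeasure.integral_fun_sub (integrable_of_continuous (hDφx a))
          (integrable_of_continuous (hDφx (τ t)))).symm
      rw [hsub]
      refine abs_pairing_le _ ((hDφx a).sub (hDφx (τ t))) fun x => ?_
      have := h2 (a := (a, x)) (b := (τ t, x)) (by
        rw [Prod.dist_eq, dist_self, max_eq_left dist_nonneg, Subtype.dist_eq, Real.dist_eq]
        exact (hdist _ hτt).2.trans_le hm2)
      rw [Pi.sub_apply, ← dist_eq_norm]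
      exact this.le
    have hA' := setIntegral_Ioc_sub (integrable_continuous _ hA) hab
    have hf' := setIntegral_Ioc_sub hf hab'
    have hg' := setIntegral_Ioc_sub hg hab'
    have e1' := abs_le.1 e1
    have e2' := abs_le.1 e2
    have e3' := abs_le.1 e3
    have hAb : A b = ∫ x : Ω, deriv (fun r => φ (r, (x : EuclideanSpace ℝ (Fin d)))) b
      ∂(ρ b : Measure Ω) := rfl
    rw [← hAb] at e1'
    have hV : ε * (V b - V a) = ε * (b - a) + ε * (b - a) +
        ε * ∫ t in Ioc (τ.symm a) (τ.symm b), g t := by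
      simp only [V]; rw [← hg']; ring
    rw [hV]
    simp only [D]
    rw [abs_le]
    constructor <;> linarith [e1'.1, e1'.2, e2'.1, e2'.2, e3'.1, e3'.2]
  have hz1 : ∫ x : Ω, φ (((1 : I) : ℝ), x) ∂(ρ 1 : Measure Ω) = 0 := by
    simp [fun x : Ω => (h0 x x.2).2]
  have hz0 : ∫ x : Ω, φ (((0 : I) : ℝ), x) ∂(ρ 0 : Measure Ω) = 0 := by
    simp [fun x : Ω => (h0 x x.2).1]
  simp only [D, hz0, hz1, hτ0, hτ1, Ioc_self, Measure.restrict_empty, integral_zero_measure,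
    setIntegral_Ioc_zero_one] at hD
  linarith

/-- After the change of time that normalizes the mass of the flux, the curve is Lipschitz against
smooth functions. -/
lemma lipschitz_timeChange (hq : IsL1Flux p.2) (hc : ContinuityEquation p) {τ : I ≃o I}
    {C : ℝ} (hC : ∫⁻ t, (massBound (p.2 t) + 1) ≤ ENNReal.ofReal C) (hC0 : 0 ≤ C)
    (hτ : (volume.withDensity fun t => massBound (p.2 t) + 1).map τ =
      (∫⁻ t, massBound (p.2 t) + 1) • (volume : Measure I))
    {ψ : EuclideanSpace ℝ (Fin d) → ℝ} (hψ : ContDiff ℝ ∞ ψ) {L : ℝ}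
    (hL : ∀ x : Ω, ‖fderiv ℝ ψ x‖ ≤ L) (s t : I) :
    |∫ x : Ω, ψ x ∂(p.1 (τ.symm s) : Measure Ω) - ∫ x : Ω, ψ x ∂(p.1 (τ.symm t) : Measure Ω)|
      ≤ L * C * dist s t := by
  wlog hst : s ≤ t generalizing s t
  · rw [abs_sub_comm, dist_comm]
    exact this t s (le_of_not_ge hst)
  have hL0 : 0 ≤ L := (norm_nonneg _).trans (hL (Classical.arbitrary Ω))
  have hDψ : Continuous fun x : Ω => fderiv ℝ ψ x :=
    (hψ.continuous_fderiv (by simp)).comp continuous_subtype_val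
  rw [abs_sub_comm, integral_sub_integral_eq hq hc hψ (τ.symm.monotone hst)]
  -- The interval of old times is the preimage under `τ` of `Ioc s t`, so the normalization bounds
  -- its flux mass by `C (t - s)`.
  have hmass : ∫ r in Ioc (τ.symm s) (τ.symm t), (massBound (p.2 r)).toReal ≤ C * dist s t := by
    rw [integral_toReal (aemeasurable_massBound hq.1).restrict
      (ae_of_all _ fun r => (massBound_ne_top _).lt_top)]
    refine ENNReal.toReal_le_of_le_ofReal (by positivity) ?_
    calc ∫⁻ r in Ioc (τ.symm s) (τ.symm t), massBound (p.2 r)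
        ≤ ∫⁻ r in Ioc (τ.symm s) (τ.symm t), (massBound (p.2 r) + 1) :=
          lintegral_mono fun r => le_self_add
      _ = ((volume.withDensity fun t => massBound (p.2 t) + 1).map τ) (Ioc s t) := by
          rw [Measure.map_apply τ.continuous.measurable measurableSet_Ioc, τ.preimage_Ioc,
            withDensity_apply _ measurableSet_Ioc]
      _ ≤ ENNReal.ofReal C * ENNReal.ofReal (t - s) := by
          rw [hτ, Measure.smul_apply, unitInterval.volume_Ioc, smul_eq_mul]
          gcongr
      _ = ENNReal.ofReal (C * dist s t) := by
          rw [← ENNReal.ofReal_mul hC0, Subtype.dist_eq, dist_comm, Real.dist_eq,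
            abs_of_nonneg (sub_nonneg.2 (show (s : ℝ) ≤ t from hst))]
  calc |∫ r in Ioc (τ.symm s) (τ.symm t), pairing (p.2 r) fun x : Ω => fderiv ℝ ψ x|
      ≤ ∫ r in Ioc (τ.symm s) (τ.symm t), L * (massBound (p.2 r)).toReal :=
        (Real.norm_eq_abs _).symm.le.trans <|
        norm_integral_le_of_norm_le ((integrable_massBound hq).integrableOn.const_mul L)
          (ae_of_all _ fun r => abs_pairing_le _ hDψ hL)
    _ = L * ∫ r in Ioc (τ.symm s) (τ.symm t), (massBound (p.2 r)).toReal := integral_const_mul _ _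
    _ ≤ L * (C * dist s t) := by gcongr
    _ = L * C * dist s t := by ring

end Flux

/-- The closed unit ball of `ℝ^d`, as the space of directions. -/
abbrev UnitBall (d : ℕ) : Type := Metric.closedBall (0 : EuclideanSpace ℝ (Fin d)) 1

instance (d : ℕ) : Nonempty (UnitBall d) := ⟨⟨0, by simp⟩⟩

instance (d : ℕ) : CompactSpace (UnitBall d) :=
  isCompact_iff_compactSpace.1 (isCompact_closedBall _ _)

lemma norm_unitBall_le {d : ℕ} (w : UnitBall d) : ‖(w : EuclideanSpace ℝ (Fin d))‖ ≤ 1 :=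
  mem_closedBall_zero_iff.1 w.2

/-- The direction of a vector. -/
def direction {d : ℕ} (v : EuclideanSpace ℝ (Fin d)) : UnitBall d :=
  ⟨‖v‖⁻¹ • v, by
    rw [mem_closedBall_zero_iff, norm_smul, norm_inv, norm_norm]
    exact inv_mul_le_one⟩

/-- The zero vector has direction 0, thanks to `0⁻¹ = 0`, so the decomposition holds without
exception; this is one use of the ball in place of the sphere. -/
lemma norm_smul_direction {d : ℕ} (v : EuclideanSpace ℝ (Fin d)) :
    ‖v‖ • (direction v : EuclideanSpace ℝ (Fin d)) = v := by
  rcases eq_or_ne v 0 with rfl | hv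
  · simp
  · simp [direction, smul_smul, norm_ne_zero_iff.2 hv]

lemma measurable_direction {d : ℕ} : Measurable (direction (d := d)) :=
  (measurable_norm.inv.smul measurable_id).subtype_mk

/-! ### Fluxes as positive measures on times, positions and directions. -/

section Lift

variable {d : ℕ} {Ω : Set (EuclideanSpace ℝ (Fin d))}
  {q : I → VectorMeasure Ω (EuclideanSpace ℝ (Fin d))}

/-- The discretization of a flux, as a positive measure on times, positions and directions. -/
def liftedMeasure (q : I → VectorMeasure Ω (EuclideanSpace ℝ (Fin d))) (τ : I → I)
    (π : SimpleFunc Ω Ω) : Measure (I × Ω × UnitBall d) :=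
  ∑ y ∈ π.range, (volume.withDensity fun t => ‖q t (π ⁻¹' {y})‖ₑ).map
    fun t => (τ t, y, direction (q t (π ⁻¹' {y})))

lemma aemeasurable_lift_map (hq : ∀ B : Set Ω, MeasurableSet B → AEMeasurable fun t => q t B)
    {τ : I → I} (hτ : Measurable τ) (π : SimpleFunc Ω Ω) (y : Ω) :
    AEMeasurable fun t => (τ t, y, direction (q t (π ⁻¹' {y}))) :=
  hτ.aemeasurable.prodMk (aemeasurable_const.prodMk
    (measurable_direction.comp_aemeasurable (hq _ (π.measurableSet_fiber y))))

lemma lintegral_liftedMeasure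
    (hq : ∀ B : Set Ω, MeasurableSet B → AEMeasurable fun t => q t B)
    {τ : I → I} (hτ : Measurable τ) (π : SimpleFunc Ω Ω) {F : I × Ω × UnitBall d → ℝ≥0∞}
    (hF : Measurable F) :
    ∫⁻ z, F z ∂liftedMeasure q τ π =
      ∫⁻ t, ∑ y ∈ π.range, F (τ t, y, direction (q t (π ⁻¹' {y}))) * ‖q t (π ⁻¹' {y})‖ₑ := by
  have hm := aemeasurable_lift_map hq hτ π
  have hn : ∀ y, AEMeasurable fun t => ‖q t (π ⁻¹' {y})‖ₑ := fun y =>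
    (hq _ (π.measurableSet_fiber y)).enorm
  have hp : ∀ y ∈ π.range, AEMeasurable fun t =>
      F (τ t, y, direction (q t (π ⁻¹' {y}))) * ‖q t (π ⁻¹' {y})‖ₑ := fun y _ =>
    (hF.comp_aemeasurable (hm y)).mul (hn y)
  rw [liftedMeasure, lintegral_finsetSum_measure, lintegral_finsetSum' _ hp]
  refine Finset.sum_congr rfl fun y _ => ?_
  rw [lintegral_map' hF.aemeasurable ((hm y).mono' (withDensity_absolutelyContinuous _ _))]
  refine (lintegral_withDensity_eq_lintegral_mul₀ (hn y)
    (hF.comp_aemeasurable (hm y))).trans (lintegral_congr fun t => ?_)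
  exact mul_comm _ _

variable [CompactSpace Ω] [Nonempty Ω]

lemma lintegral_enorm_apply_ne_top (hq : IsL1Flux q) (A : Set Ω) : ∫⁻ t, ‖q t A‖ₑ ≠ ⊤ := by
  refine ((lintegral_mono fun t => ?_).trans_lt hq.2).ne
  exact (VectorMeasure.enorm_measure_le_variation (q t) A).trans (measure_mono (subset_univ _))

lemma isFiniteMeasure_liftedMeasure (hq : IsL1Flux q) {τ : I → I} (hτ : Measurable τ)
    (π : SimpleFunc Ω Ω) : IsFiniteMeasure (liftedMeasure q τ π) := by
  refine ⟨?_⟩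
  rw [← lintegral_one, lintegral_liftedMeasure hq.1 hτ π measurable_const,
    lintegral_finsetSum' _ fun y _ => ((hq.1 _ (π.measurableSet_fiber y)).enorm.const_mul 1)]
  refine ENNReal.sum_lt_top.2 fun y _ => ?_
  simpa using (lintegral_enorm_apply_ne_top hq _).lt_top

/-- Density times direction recovers `q`, so an expression linear in the flux becomes the integral
of a continuous function against a positive measure, accessible to weak limits. -/
lemma integral_liftedMeasure (hq : IsL1Flux q) {τ : I → I} (hτ : Continuous τ)
    (π : SimpleFunc Ω Ω) {f : I → Ω → EuclideanSpace ℝ (Fin d) →L[ℝ] ℝ}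
    (hf : Continuous fun p : I × Ω => f p.1 p.2) :
    ∫ z, f z.1 z.2.1 z.2.2 ∂liftedMeasure q τ π = ∫ t, riemannSum (q t) π (f (τ t)) := by
  have hm := aemeasurable_lift_map hq.1 hτ.measurable π
  have hF : Continuous fun z : I × Ω × UnitBall d => f z.1 z.2.1 z.2.2 :=
    (hf.comp (continuous_fst.prodMk (continuous_fst.comp continuous_snd))).clm_apply
      (continuous_subtype_val.comp (continuous_snd.comp continuous_snd))
  have hn : ∀ y, AEMeasurable fun t => ‖q t (π ⁻¹' {y})‖ₑ := fun y =>
    (hq.1 _ (π.measurableSet_fiber y)).enorm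
  have hfin : ∀ y : Ω, IsFiniteMeasure
      ((volume : Measure I).withDensity fun t => ‖q t (π ⁻¹' {y})‖ₑ) := fun y =>
    isFiniteMeasure_withDensity (lintegral_enorm_apply_ne_top hq _)
  have hterm : ∀ y : Ω, ∀ t, (‖q t (π ⁻¹' {y})‖ₑ).toReal •
      (f (τ t) y) (direction (q t (π ⁻¹' {y})) : EuclideanSpace ℝ (Fin d)) =
        f (τ t) y (q t (π ⁻¹' {y})) := fun y t => by
    rw [toReal_enorm, ← map_smul, norm_smul_direction]
  have hint : ∀ y : Ω, Integrable fun t => f (τ t) y (q t (π ⁻¹' {y})) := fun y => by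
    have h1 : Continuous fun t => f (τ t) y := hf.comp (hτ.prodMk continuous_const)
    obtain ⟨C, hC⟩ := isCompact_univ.exists_bound_of_continuousOn h1.continuousOn
    have h2 : Integrable fun t => q t (π ⁻¹' {y}) :=
      ⟨(hq.1 _ (π.measurableSet_fiber y)).aestronglyMeasurable,
        (lintegral_enorm_apply_ne_top hq _).lt_top⟩
    refine (h2.norm.const_mul C).mono' ((isBoundedBilinearMap_apply
      (𝕜 := ℝ)).continuous.comp_aestronglyMeasurable
      (h1.aestronglyMeasurable.prodMk h2.aestronglyMeasurable)) (ae_of_all _ fun t => ?_)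
    exact ((f (τ t) y).le_opNorm _).trans (by gcongr; exact hC t (mem_univ _))
  rw [liftedMeasure, integral_finsetSum_measure fun y _ => integrable_continuous _ hF]
  unfold riemannSum
  rw [integral_finsetSum _ fun y _ => hint y]
  refine Finset.sum_congr rfl fun y _ => ?_
  rw [integral_map ((hm y).mono' (withDensity_absolutelyContinuous _ _)) hF.aestronglyMeasurable,
    integral_withDensity_eq_integral_toReal_smul₀ (hn y) (ae_of_all _ fun t => by simp)]
  simp_rw [hterm]

/-- At each time the fibres carry at most `massBound`. After the normalizing time change the right
side is a multiple of Lebesgue measure. -/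
lemma fst_liftedMeasure_le (hq : IsL1Flux q) {τ : I → I} (hτ : Measurable τ) (n : ℕ) :
    (liftedMeasure q τ (mesh Ω n)).fst ≤
      (volume.withDensity fun t => massBound (q t) + 1).map τ := by
  refine Measure.le_iff.2 fun s hs => ?_
  rw [Measure.fst_apply hs, Measure.map_apply hτ hs, withDensity_apply _ (hτ hs),
    ← lintegral_indicator_one (measurable_fst hs),
    lintegral_liftedMeasure hq.1 hτ _ (measurable_one.indicator (measurable_fst hs)),
    ← lintegral_indicator (hτ hs)]
  refine lintegral_mono fun t => ?_
  by_cases ht : τ t ∈ s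
  · simp only [indicator, mem_preimage, ht, if_true, Pi.one_apply, one_mul]
    exact (le_iSup (fun n => partitionMass (q t) (mesh Ω n)) n).trans le_self_add
  · simp [indicator, ht]

end Lift

/-! ### Disintegration of lifted measures into fluxes. -/

section Realization

variable {d : ℕ} {Ω : Set (EuclideanSpace ℝ (Fin d))} [CompactSpace Ω] [Nonempty Ω]

/-- The flux of a finite measure on positions and directions. -/
def fluxOf (lam : Measure (Ω × UnitBall d)) : VectorMeasure Ω (EuclideanSpace ℝ (Fin d)) :=
  (lam.withDensityᵥ fun z => (z.2 : EuclideanSpace ℝ (Fin d))).map Prod.fst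

lemma continuous_direction_coe :
    Continuous fun z : Ω × UnitBall d => (z.2 : EuclideanSpace ℝ (Fin d)) :=
  continuous_subtype_val.comp continuous_snd

lemma fluxOf_apply (lam : Measure (Ω × UnitBall d)) [IsFiniteMeasure lam] {A : Set Ω}
    (hA : MeasurableSet A) :
    fluxOf lam A = ∫ z in Prod.fst ⁻¹' A, (z.2 : EuclideanSpace ℝ (Fin d)) ∂lam := by
  rw [fluxOf, VectorMeasure.map_apply _ measurable_fst hA,
    withDensityᵥ_apply (integrable_continuous _ continuous_direction_coe) (measurable_fst hA)]

lemma enorm_fluxOf_le (lam : Measure (Ω × UnitBall d)) [IsFiniteMeasure lam] {A : Set Ω}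
    (hA : MeasurableSet A) : ‖fluxOf lam A‖ₑ ≤ lam.map Prod.fst A := by
  rw [fluxOf_apply lam hA, Measure.map_apply measurable_fst hA]
  refine (enorm_integral_le_lintegral_enorm _).trans ?_
  calc ∫⁻ z in Prod.fst ⁻¹' A, ‖(z.2 : EuclideanSpace ℝ (Fin d))‖ₑ ∂lam
      ≤ ∫⁻ z in Prod.fst ⁻¹' A, 1 ∂lam := by
        refine lintegral_mono fun z => ?_
        rw [← ofReal_norm]
        exact ENNReal.ofReal_le_one.2 (norm_unitBall_le z.2)
    _ = lam (Prod.fst ⁻¹' A) := by simp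

/-- The two sides agree for integrands constant on the fibres of the mesh, by definition of the flux
as an average of directions; both pass to the limit. -/
lemma pairing_fluxOf (lam : Measure (Ω × UnitBall d)) [IsFiniteMeasure lam]
    {f : Ω → EuclideanSpace ℝ (Fin d) →L[ℝ] ℝ} (hf : Continuous f) :
    pairing (fluxOf lam) f = ∫ z, f z.1 z.2 ∂lam := by
  have hi : Integrable (fun z : Ω × UnitBall d => (z.2 : EuclideanSpace ℝ (Fin d))) lam :=
    integrable_continuous _ continuous_direction_coe
  obtain ⟨C, hC⟩ := isCompact_univ.exists_bound_of_continuousOn hf.continuousOn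
  have hsum : ∀ n, riemannSum (fluxOf lam) (mesh Ω n) f = ∫ z, f (mesh Ω n z.1) z.2 ∂lam := by
    intro n
    have hpt : ∀ z : Ω × UnitBall d, f (mesh Ω n z.1) z.2 = ∑ y ∈ (mesh Ω n).range,
        (Prod.fst ⁻¹' (mesh Ω n ⁻¹' {y})).indicator
          (fun z : Ω × UnitBall d => f y z.2) z := by
      intro z
      rw [Finset.sum_eq_single (mesh Ω n z.1)]
      · simp
      · intro y _ hy
        simp [Ne.symm hy]
      · intro h; exact absurd ((mesh Ω n).mem_range_self z.1) h
    simp_rw [hpt]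
    have hms : ∀ y, MeasurableSet (Prod.fst ⁻¹' (mesh Ω n ⁻¹' {y}) : Set (Ω × UnitBall d)) :=
      fun y => measurable_fst ((mesh Ω n).measurableSet_fiber y)
    rw [integral_finsetSum _ fun y _ => ((f y).integrable_comp hi).indicator (hms y)]
    refine Finset.sum_congr rfl fun y _ => ?_
    rw [integral_indicator (hms y), fluxOf_apply lam ((mesh Ω n).measurableSet_fiber y)]
    exact ((f y).integral_comp_comm hi.integrableOn).symm
  refine tendsto_nhds_unique (tendsto_riemannSum (fluxOf lam) hf) ?_
  simp_rw [hsum]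
  refine tendsto_integral_of_dominated_convergence (fun _ => C) (fun n => ?_)
    (integrable_const _) (fun n => ae_of_all _ fun z => ?_) (ae_of_all _ fun z => ?_)
  · have h1 : StronglyMeasurable fun z : Ω × UnitBall d => f (mesh Ω n z.1) :=
      (SimpleFunc.stronglyMeasurable ((mesh Ω n).map f)).comp_measurable measurable_fst
    exact (isBoundedBilinearMap_apply (𝕜 := ℝ)).continuous.comp_aestronglyMeasurable
      (h1.aestronglyMeasurable.prodMk hi.aestronglyMeasurable)
  · refine ((f _).le_opNorm _).trans ?_
    calc ‖f (mesh Ω n z.1)‖ * ‖(z.2 : EuclideanSpace ℝ (Fin d))‖ ≤ C * 1 := by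
          gcongr
          · exact (norm_nonneg _).trans (hC (Classical.arbitrary Ω) (mem_univ _))
          · exact hC _ (mem_univ _)
          · exact norm_unitBall_le z.2
      _ = C := mul_one C
  · have h1 : Continuous fun x => f x (z.2 : EuclideanSpace ℝ (Fin d)) :=
      hf.clm_apply continuous_const
    exact (h1.tendsto z.1).comp (tendsto_mesh z.1)

/-- A lifted measure whose time marginal has a density disintegrates into a flux. -/
lemma exists_flux_of_lift (M : Measure (I × Ω × UnitBall d)) [IsFiniteMeasure M]
    (hM : M.fst ≪ volume) :
    ∃ (q : I → VectorMeasure Ω (EuclideanSpace ℝ (Fin d))) (ν : I → Measure Ω),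
      IsL1Flux q ∧ (∀ t A, MeasurableSet A → ‖q t A‖ₑ ≤ ν t A) ∧
      (∀ f : I → Ω → EuclideanSpace ℝ (Fin d) →L[ℝ] ℝ, (Continuous fun p : I × Ω => f p.1 p.2) →
        ∫ t, pairing (q t) (f t) = ∫ z, f z.1 z.2.1 z.2.2 ∂M) ∧
      (∀ h : I × Ω → ℝ≥0∞, Measurable h →
        ∫⁻ t, ∫⁻ x, h (t, x) ∂ν t = ∫⁻ z, h (z.1, z.2.1) ∂M) := by
  -- The time density is truncated to finite values, which changes it only on a null set and makes
  -- every slice `lam t` a finite measure.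
  let θ : I → NNReal := fun t => (M.fst.rnDeriv volume t).toNNReal
  have hθ : Measurable θ := (Measure.measurable_rnDeriv _ _).ennreal_toNNReal
  have hfst : M.fst = volume.withDensity fun t => (θ t : ℝ≥0∞) := by
    rw [← Measure.withDensity_rnDeriv_eq _ _ hM]
    refine withDensity_congr_ae ?_
    filter_upwards [Measure.rnDeriv_lt_top M.fst volume] with t ht
    exact (ENNReal.coe_toNNReal ht.ne).symm
  let lam : I → Measure (Ω × UnitBall d) := fun t => θ t • M.condKernel t
  have hlam : ∀ t, IsFiniteMeasure (lam t) := fun t => inferInstance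
  have hν : ∀ h : I × Ω → ℝ≥0∞, Measurable h →
      ∫⁻ t, ∫⁻ x, h (t, x) ∂(lam t).map Prod.fst = ∫⁻ z, h (z.1, z.2.1) ∂M := by
    intro h hh
    have hh' : Measurable fun z : I × Ω × UnitBall d => h (z.1, z.2.1) := by fun_prop
    rw [← Measure.lintegral_condKernel hh', hfst, lintegral_withDensity_eq_lintegral_mul _
      hθ.coe_nnreal_ennreal (hh'.lintegral_kernel_prod_right')]
    refine lintegral_congr fun t => ?_
    rw [lintegral_map (by fun_prop) measurable_fst]
    exact lintegral_smul_measure _ _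
  refine ⟨fun t => fluxOf (lam t), fun t => (lam t).map Prod.fst, ⟨fun B hB => ?_, ?_⟩,
    fun t A hA => enorm_fluxOf_le _ hA, fun f hf => ?_, hν⟩
  · have h1 : ∀ t, fluxOf (lam t) B = θ t • ∫ z, (Prod.fst ⁻¹' B).indicator
        (fun z : Ω × UnitBall d => (z.2 : EuclideanSpace ℝ (Fin d))) z ∂M.condKernel t := by
      intro t
      rw [fluxOf_apply _ hB, integral_indicator (measurable_fst hB)]
      simp only [lam, Measure.restrict_smul]
      exact integral_smul_nnreal_measure _ _
    simp_rw [h1]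
    refine (hθ.smul ?_).aemeasurable
    exact (StronglyMeasurable.integral_kernel (κ := M.condKernel)
      (continuous_direction_coe.stronglyMeasurable.indicator (measurable_fst hB))).measurable
  · calc ∫⁻ t, (fluxOf (lam t)).variation univ
        ≤ ∫⁻ t, ((lam t).map Prod.fst) univ := lintegral_mono fun t =>
          VectorMeasure.variation_le_of_forall_enorm_le (fun A hA => enorm_fluxOf_le _ hA) univ
      _ = M univ := by simpa using hν (fun _ => 1) measurable_const
      _ < ⊤ := measure_lt_top _ _
  · have hF : Continuous fun z : I × Ω × UnitBall d => f z.1 z.2.1 z.2.2 :=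
      (hf.comp (continuous_fst.prodMk (continuous_fst.comp continuous_snd))).clm_apply
        (continuous_subtype_val.comp (continuous_snd.comp continuous_snd))
    rw [← Measure.integral_condKernel (integrable_continuous M hF), hfst,
      integral_withDensity_eq_integral_smul hθ]
    refine integral_congr_ae (ae_of_all _ fun t => ?_)
    simp only []
    have hft : Continuous (f t) := hf.comp ((continuous_const (y := t)).prodMk continuous_id)
    rw [pairing_fluxOf (lam t) hft]
    exact integral_smul_nnreal_measure _ _

end Realization

/-! ### The lifted continuity equation. -/

section Realization

variable {d : ℕ} {Ω : Set (EuclideanSpace ℝ (Fin d))} [CompactSpace Ω] [Nonempty Ω]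

lemma continuous_smoothedWeight_curve (α : ℝ) (k : ℕ) {ρ : I → ProbabilityMeasure Ω}
    (hρ : Continuous ρ) : Continuous fun z : I × Ω => smoothedWeight α k (ρ z.1) z.2 :=
  (continuous_smoothedWeight α k).comp ((hρ.comp continuous_fst).prodMk continuous_snd)

lemma measurable_atomWeight_curve (α : ℝ) {ρ : I → ProbabilityMeasure Ω} (hρ : Continuous ρ) :
    Measurable fun z : I × Ω => atomWeight α (ρ z.1 : Measure Ω) z.2 :=
  measurable_of_tendsto_metrizable
    (fun k => (continuous_smoothedWeight_curve α k hρ).measurable.ennreal_ofReal)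
    (tendsto_pi_nhds.2 fun z => tendsto_smoothedWeight α (ρ z.1) z.2)

/-- The weak continuity equation between a curve of probability measures and a positive measure
on times, positions and directions. -/
def LiftedEquation (ρ : C(I, ProbabilityMeasure Ω)) (M : Measure (I × Ω × UnitBall d)) : Prop :=
  ∀ φ : ℝ × EuclideanSpace ℝ (Fin d) → ℝ, ContDiff ℝ ∞ φ →
    (∀ x ∈ Ω, φ (0, x) = 0 ∧ φ (1, x) = 0) →
    (∫ t : I, ∫ x : Ω, deriv (fun s => φ (s, (x : EuclideanSpace ℝ (Fin d)))) (t : ℝ)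
      ∂(ρ t : Measure Ω)) +
      ∫ z, fderiv ℝ (fun y => φ ((z.1 : ℝ), y)) (z.2.1 : EuclideanSpace ℝ (Fin d)) z.2.2 ∂M = 0

lemma continuous_deriv_left_subtype {φ : ℝ × EuclideanSpace ℝ (Fin d) → ℝ}
    (hφ : ContDiff ℝ ∞ φ) : Continuous fun z : I × Ω =>
      deriv (fun r => φ (r, (z.2 : EuclideanSpace ℝ (Fin d)))) z.1 :=
  (continuous_deriv_left hφ).comp ((continuous_subtype_val.comp continuous_fst).prodMk
    (continuous_subtype_val.comp continuous_snd))

lemma continuous_fderiv_right_subtype {φ : ℝ × EuclideanSpace ℝ (Fin d) → ℝ}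
    (hφ : ContDiff ℝ ∞ φ) : Continuous fun z : I × Ω =>
      fderiv ℝ (fun y => φ ((z.1 : ℝ), y)) (z.2 : EuclideanSpace ℝ (Fin d)) :=
  (continuous_fderiv_right hφ).comp ((continuous_subtype_val.comp continuous_fst).prodMk
    (continuous_subtype_val.comp continuous_snd))

/-- Averaging directions can only lose mass, so the position marginal of each time slice dominates
the flux, and the weighted integral bounds the cost. -/
lemma exists_flux_of_liftedEquation (ρ : C(I, ProbabilityMeasure Ω))
    (M : Measure (I × Ω × UnitBall d)) [IsFiniteMeasure M] (hM : M.fst ≪ volume)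
    (heq : LiftedEquation ρ M) :
    ∃ q, IsL1Flux q ∧ ContinuityEquation (ρ, q) ∧ ∀ α, 0 < α → α < 1 →
      totalCost α (ρ, q) ≤ ∫⁻ z, atomWeight α (ρ z.1 : Measure Ω) z.2.1 ∂M := by
  obtain ⟨q, ν, hq, hν, hpair, hlin⟩ := exists_flux_of_lift M hM
  refine ⟨q, hq, fun φ hφ h0 => ?_, fun α hα₀ hα₁ => ?_⟩
  · have hf := continuous_fderiv_right_subtype (Ω := Ω) hφ
    rw [integral_add]
    · have := hpair (fun t x => fderiv ℝ (fun y => φ ((t : ℝ), y)) x) hf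
      refine Eq.trans ?_ (heq φ hφ h0)
      rw [← this]
    · exact integrable_continuous _
        (continuous_integral_curve ρ.continuous (continuous_deriv_left_subtype hφ))
    · exact integrable_pairing hq hf
  · rw [← hlin _ (measurable_atomWeight_curve α ρ.continuous)]
    exact lintegral_mono fun t => instantCost_le_lintegral hα₀ hα₁ _ (hν t)

end Realization

/-! ### An admissible pair by displacement interpolation. -/

section Displacement

variable {d : ℕ} {Ω : Set (EuclideanSpace ℝ (Fin d))}

/-- The point `(1 - t) x + t y` of a convex set. -/
def segmentPoint (hconv : Convex ℝ Ω) (t : I) (z : Ω × Ω) : Ω :=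
  ⟨(1 - (t : ℝ)) • (z.1 : EuclideanSpace ℝ (Fin d)) + (t : ℝ) • (z.2 : EuclideanSpace ℝ (Fin d)),
    hconv z.1.2 z.2.2 (sub_nonneg.2 t.2.2) t.2.1 (sub_add_cancel _ _)⟩

lemma continuous_segmentPoint (hconv : Convex ℝ Ω) :
    Continuous fun w : I × Ω × Ω => segmentPoint hconv w.1 w.2 := by
  unfold segmentPoint
  fun_prop

lemma continuous_segmentPoint_right (hconv : Convex ℝ Ω) (t : I) :
    Continuous (segmentPoint hconv t) :=
  (continuous_segmentPoint hconv).comp (continuous_const.prodMk continuous_id)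

/-- The direction of the segment from `x` to `y`, scaled by `R`. -/
def segmentDirection {R : ℝ}
    (hR : ∀ z : Ω × Ω, ‖(z.2 : EuclideanSpace ℝ (Fin d)) - z.1‖ ≤ R) (z : Ω × Ω) : UnitBall d :=
  ⟨R⁻¹ • ((z.2 : EuclideanSpace ℝ (Fin d)) - z.1), by
    have hR0 : 0 ≤ R := (norm_nonneg _).trans (hR z)
    rw [mem_closedBall_zero_iff, norm_smul, norm_inv, Real.norm_of_nonneg hR0]
    exact (mul_le_mul_of_nonneg_left (hR z) (inv_nonneg.2 hR0)).trans inv_mul_le_one⟩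

lemma continuous_segmentDirection {R : ℝ}
    (hR : ∀ z : Ω × Ω, ‖(z.2 : EuclideanSpace ℝ (Fin d)) - z.1‖ ≤ R) :
    Continuous (segmentDirection hR) := by
  unfold segmentDirection
  fun_prop

/-- The displacement interpolation of the product coupling. -/
def displacement [CompactSpace Ω] (hconv : Convex ℝ Ω) (μ₀ μ₁ : ProbabilityMeasure Ω) :
    C(I, ProbabilityMeasure Ω) where
  toFun t := (μ₀.prod μ₁).map (continuous_segmentPoint_right hconv t).aemeasurable
  continuous_toFun := by
    rw [continuous_iff_continuousAt]
    intro t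
    rw [ContinuousAt, tendsto_probabilityMeasure_iff]
    intro f
    have h : ∀ s, ∫ x, f x ∂((μ₀.prod μ₁).map
        (continuous_segmentPoint_right hconv s).aemeasurable : Measure Ω) =
        ∫ z, f (segmentPoint hconv s z) ∂(μ₀.prod μ₁ : Measure (Ω × Ω)) := fun s => by
      rw [ProbabilityMeasure.toMeasure_map]
      exact integral_map (continuous_segmentPoint_right hconv s).aemeasurable
        f.continuous.aestronglyMeasurable
    simp_rw [h]
    exact (continuous_integral_param (f := fun s z => f (segmentPoint hconv s z))
      (f.continuous.comp (continuous_segmentPoint hconv))).comp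
        (continuous_const.prodMk continuous_id) |>.tendsto t

lemma toMeasure_displacement [CompactSpace Ω] (hconv : Convex ℝ Ω) (μ₀ μ₁ : ProbabilityMeasure Ω)
    (t : I) : (displacement hconv μ₀ μ₁ t : Measure Ω) =
      ((μ₀ : Measure Ω).prod μ₁).map (segmentPoint hconv t) :=
  ProbabilityMeasure.toMeasure_map _ (continuous_segmentPoint_right hconv t).aemeasurable

lemma integral_displacement [CompactSpace Ω] (hconv : Convex ℝ Ω) (μ₀ μ₁ : ProbabilityMeasure Ω)
    (t : I) {f : Ω → ℝ} (hf : Continuous f) :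
    ∫ x, f x ∂(displacement hconv μ₀ μ₁ t : Measure Ω) =
      ∫ z, f (segmentPoint hconv t z) ∂(μ₀.prod μ₁ : Measure (Ω × Ω)) := by
  rw [toMeasure_displacement]
  exact integral_map (continuous_segmentPoint_right hconv t).aemeasurable hf.aestronglyMeasurable

lemma displacement_zero [CompactSpace Ω] (hconv : Convex ℝ Ω) (μ₀ μ₁ : ProbabilityMeasure Ω) :
    displacement hconv μ₀ μ₁ 0 = μ₀ := by
  have : segmentPoint hconv 0 = Prod.fst := by ext z; simp [segmentPoint]
  apply Subtype.ext
  change (displacement hconv μ₀ μ₁ _ : Measure Ω) = _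
  rw [toMeasure_displacement, this]
  exact Measure.fst_prod (μ := (μ₀ : Measure Ω)) (ν := (μ₁ : Measure Ω))

lemma displacement_one [CompactSpace Ω] (hconv : Convex ℝ Ω) (μ₀ μ₁ : ProbabilityMeasure Ω) :
    displacement hconv μ₀ μ₁ 1 = μ₁ := by
  have : segmentPoint hconv 1 = Prod.snd := by ext z; simp [segmentPoint]
  apply Subtype.ext
  change (displacement hconv μ₀ μ₁ _ : Measure Ω) = _
  rw [toMeasure_displacement, this]
  exact Measure.snd_prod (μ := (μ₀ : Measure Ω)) (ν := (μ₁ : Measure Ω))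

/-- The integrand is the total derivative of `φ (t, γ t)` along the segment `γ`, and `φ` vanishes at
both ends. -/
lemma integral_deriv_along_segment (hconv : Convex ℝ Ω) {φ : ℝ × EuclideanSpace ℝ (Fin d) → ℝ}
    (hφ : ContDiff ℝ ∞ φ) (h0 : ∀ x ∈ Ω, φ (0, x) = 0 ∧ φ (1, x) = 0) (z : Ω × Ω) :
    ∫ t : I, (deriv (fun s => φ (s, (segmentPoint hconv t z : EuclideanSpace ℝ (Fin d)))) t +
      fderiv ℝ (fun y => φ ((t : ℝ), y)) (segmentPoint hconv t z : EuclideanSpace ℝ (Fin d))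
        (z.2 - z.1)) = 0 := by
  let γ : ℝ → EuclideanSpace ℝ (Fin d) := fun t =>
    (1 - t) • (z.1 : EuclideanSpace ℝ (Fin d)) + t • (z.2 : EuclideanSpace ℝ (Fin d))
  have hγ : Continuous γ := by fun_prop
  let g : ℝ → ℝ := fun t => deriv (fun s => φ (s, γ t)) t +
    fderiv ℝ (fun y => φ (t, y)) (γ t) (z.2 - z.1)
  have hg : Continuous g := ((continuous_deriv_left hφ).comp (continuous_id.prodMk hγ)).add
    (((continuous_fderiv_right hφ).comp (continuous_id.prodMk hγ)).clm_apply continuous_const)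
  have hd : ∀ t, HasDerivAt (fun t => φ (t, γ t)) (g t) t := by
    intro t
    have h1 : HasFDerivAt φ (fderiv ℝ φ (t, γ t)) (t, γ t) :=
      (hφ.differentiable (by simp)).differentiableAt.hasFDerivAt
    have h2 : HasDerivAt γ ((z.2 : EuclideanSpace ℝ (Fin d)) - z.1) t := by
      refine (((((hasDerivAt_id t).const_sub 1).smul_const (z.1 : EuclideanSpace ℝ (Fin d))).add
        ((hasDerivAt_id t).smul_const (z.2 : EuclideanSpace ℝ (Fin d))))).congr_deriv ?_
      rw [neg_one_smul, one_smul, neg_add_eq_sub]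
    refine (h1.comp_hasDerivAt t ((hasDerivAt_id t).prodMk h2)).congr_deriv ?_
    simp only [g, deriv_left_eq hφ, fderiv_right_eq hφ, ContinuousLinearMap.comp_apply,
      ContinuousLinearMap.inr_apply, ← map_add, Prod.mk_add_mk, add_zero, zero_add]
  change ∫ t : I, g t = 0
  rw [integral_unitInterval_comp_coe g, intervalIntegral.integral_eq_sub_of_hasDerivAt
    (fun t _ => hd t) (hg.intervalIntegrable _ _)]
  simp [γ, (h0 _ z.1.2).1, (h0 _ z.2.2).2]

/-- Mass moves along straight segments under the product coupling; convexity keeps it in `Ω`. The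
cost may be infinite, but nonemptiness is needed even when the minimal value is `+∞`. -/
lemma exists_admissible [CompactSpace Ω] [Nonempty Ω] (hconv : Convex ℝ Ω)
    (μ₀ μ₁ : ProbabilityMeasure Ω) : (admissible μ₀ μ₁).Nonempty := by
  obtain ⟨R, hR⟩ := isCompact_univ.exists_bound_of_continuousOn
    (f := fun z : Ω × Ω => (z.2 : EuclideanSpace ℝ (Fin d)) - z.1)
    (by fun_prop : Continuous _).continuousOn
  -- The bound is raised to at least 1 so that it can be divided by.
  replace hR : ∀ z : Ω × Ω, ‖(z.2 : EuclideanSpace ℝ (Fin d)) - z.1‖ ≤ max R 1 :=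
    fun z => (hR z (mem_univ _)).trans (le_max_left _ _)
  have hR0 : 0 < max R 1 := by positivity
  set R' := max R 1
  let P : Measure (Ω × Ω) := (μ₀.prod μ₁ : Measure (Ω × Ω))
  let T : I × Ω × Ω → I × Ω × UnitBall d := fun w =>
    (w.1, segmentPoint hconv w.1 w.2, segmentDirection hR w.2)
  have hT : Continuous T := continuous_fst.prodMk ((continuous_segmentPoint hconv).prodMk
    ((continuous_segmentDirection hR).comp continuous_snd))
  -- The factor `R'` restores the speed divided out in `segmentDirection`.
  let M : Measure (I × Ω × UnitBall d) := ENNReal.ofReal R' • (volume.prod P).map T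
  have : IsFiniteMeasure M := by
    have : IsFiniteMeasure ((volume.prod P).map T) := inferInstance
    exact Measure.smul_finite _ ENNReal.ofReal_ne_top
  have hM : M.fst ≪ volume := by
    have : M.fst = ENNReal.ofReal R' • volume := by
      ext s hs
      rw [Measure.fst_apply hs, Measure.smul_apply, Measure.smul_apply,
        Measure.map_apply hT.measurable (measurable_fst hs)]
      have : T ⁻¹' (Prod.fst ⁻¹' s) = s ×ˢ univ := by ext; simp [T]
      rw [this, Measure.prod_prod]
      simp [P]
    rw [this]
    exact Measure.smul_absolutelyContinuous
  have heq : LiftedEquation (displacement hconv μ₀ μ₁) M := by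
    intro φ hφ h0
    have hdc := continuous_deriv_left_subtype (Ω := Ω) hφ
    have hfc := continuous_fderiv_right_subtype (Ω := Ω) hφ
    have hseg : Continuous fun w : I × Ω × Ω => (w.1, segmentPoint hconv w.1 w.2) :=
      continuous_fst.prodMk (continuous_segmentPoint hconv)
    let a : I × Ω × Ω → ℝ := fun w =>
      deriv (fun s => φ (s, (segmentPoint hconv w.1 w.2 : EuclideanSpace ℝ (Fin d)))) w.1
    let b : I × Ω × Ω → ℝ := fun w => fderiv ℝ (fun y => φ ((w.1 : ℝ), y))
      (segmentPoint hconv w.1 w.2 : EuclideanSpace ℝ (Fin d)) (w.2.2 - w.2.1)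
    have ha : Continuous a := hdc.comp hseg
    have hb : Continuous b := (hfc.comp hseg).clm_apply (by fun_prop)
    have e1 : (∫ t : I, ∫ x : Ω, deriv (fun s => φ (s, (x : EuclideanSpace ℝ (Fin d)))) (t : ℝ)
        ∂(displacement hconv μ₀ μ₁ t : Measure Ω)) = ∫ w, a w ∂(volume.prod P) := by
      rw [integral_prod _ (integrable_continuous _ ha)]
      refine integral_congr_ae (ae_of_all _ fun t => ?_)
      exact integral_displacement hconv μ₀ μ₁ t
        (hdc.comp ((continuous_const (y := t)).prodMk continuous_id))
    have e2 : ∫ z, fderiv ℝ (fun y => φ ((z.1 : ℝ), y))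
        (z.2.1 : EuclideanSpace ℝ (Fin d)) z.2.2 ∂M = ∫ w, b w ∂(volume.prod P) := by
      have hF : Continuous fun z : I × Ω × UnitBall d => fderiv ℝ (fun y => φ ((z.1 : ℝ), y))
          (z.2.1 : EuclideanSpace ℝ (Fin d)) z.2.2 :=
        (hfc.comp (continuous_fst.prodMk (continuous_fst.comp continuous_snd))).clm_apply
          (continuous_subtype_val.comp (continuous_snd.comp continuous_snd))
      rw [integral_smul_measure, integral_map hT.aemeasurable hF.aestronglyMeasurable,
        ENNReal.toReal_ofReal hR0.le, ← integral_smul]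
      refine integral_congr_ae (ae_of_all _ fun w => ?_)
      simp only [T, b, segmentDirection, map_smul, smul_eq_mul]
      field_simp
    rw [e1, e2, ← integral_add (integrable_continuous _ ha) (integrable_continuous _ hb),
      integral_prod_symm (fun w => a w + b w) (integrable_continuous _ (ha.add hb))]
    simp only [a, b, integral_deriv_along_segment hconv hφ h0, integral_zero]
  obtain ⟨q, hq, hc, -⟩ := exists_flux_of_liftedEquation _ M hM heq
  exact ⟨(displacement hconv μ₀ μ₁, q), hq, hc, displacement_zero hconv μ₀ μ₁,
    displacement_one hconv μ₀ μ₁⟩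

end Displacement

/-! ### Domination under weak limits. -/

section WeakLimits

/-- On closed sets the bound follows from continuous functions decreasing to the indicator; inner
regularity by closed sets extends it. It keeps the limiting time marginal absolutely continuous. -/
lemma measure_le_of_tendsto {X ι : Type*} [TopologicalSpace X]
    [TopologicalSpace.PseudoMetrizableSpace X] [MeasurableSpace X] [BorelSpace X]
    {l : Filter ι} [l.NeBot] {μs : ι → FiniteMeasure X} {μ : FiniteMeasure X} {ν : Measure X}
    [IsFiniteMeasure ν] (h : Tendsto μs l (𝓝 μ)) (hle : ∀ i, (μs i : Measure X) ≤ ν) :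
    (μ : Measure X) ≤ ν := by
  have hclosed : ∀ F : Set X, IsClosed F → (μ : Measure X) F ≤ ν F := fun F hF =>
    ge_of_tendsto (HasOuterApproxClosed.tendsto_lintegral_apprSeq hF ν)
      (Eventually.of_forall fun n => (HasOuterApproxClosed.measure_le_lintegral hF _ n).trans
        (le_of_tendsto (FiniteMeasure.tendsto_iff_forall_lintegral_tendsto.1 h (hF.apprSeq n))
          (Eventually.of_forall fun i => lintegral_mono' (hle i) le_rfl)))
  refine Measure.le_iff.2 fun s hs => ?_
  rw [hs.measure_eq_iSup_isClosed_of_ne_top (measure_ne_top _ _)]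
  exact iSup₂_le fun K hK => iSup_le fun hKc => (hclosed K hKc).trans (measure_mono hK)

end WeakLimits

/-! ### Compactness and lower semicontinuity. -/

section Limit

variable {d : ℕ} {Ω : Set (EuclideanSpace ℝ (Fin d))} [CompactSpace Ω] [Nonempty Ω]

lemma eventually_dist_mesh_le {F : Type*} [PseudoMetricSpace F] {G : I × Ω → F}
    (hG : Continuous G) {ε : ℝ} (hε : 0 < ε) :
    ∀ᶠ n in atTop, ∀ s x, dist (G (s, x)) (G (s, mesh Ω n x)) < ε := by
  obtain ⟨δ, hδ, h⟩ := Metric.uniformContinuous_iff.1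
    (CompactSpace.uniformContinuous_of_continuous hG) ε hε
  obtain ⟨N, hN⟩ := exists_nat_one_div_lt hδ
  filter_upwards [eventually_ge_atTop N] with n hn s x
  refine h ?_
  rw [Prod.dist_eq, dist_self, max_eq_right dist_nonneg, dist_comm]
  refine (dist_mesh_le n x).trans_lt (lt_of_le_of_lt ?_ hN)
  gcongr

/-- The measure attaining the cost turns the discretized sum into `∫ Γ ∘ π dν`. Since the true
weight is at least 1 and lies above the smoothed one, the additive error `ε` becomes a relative
error. -/
lemma sum_ofReal_mul_enorm_le {α : ℝ} (hα₀ : 0 < α) (hα₁ : α < 1) (ρ : ProbabilityMeasure Ω)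
    (q : VectorMeasure Ω (EuclideanSpace ℝ (Fin d))) (π : SimpleFunc Ω Ω) {k : ℕ} {Γ : Ω → ℝ}
    {ε : ℝ} (h : ∀ x, Γ (π x) ≤ smoothedWeight α k ρ x + ε) :
    ∑ y ∈ π.range, ENNReal.ofReal (Γ y) * ‖q (π ⁻¹' {y})‖ₑ ≤
      (1 + ENNReal.ofReal ε) * instantCost α (ρ : Measure Ω) q := by
  by_cases htop : instantCost α (ρ : Measure Ω) q = ⊤
  · rw [htop, ENNReal.mul_top (by simp)]
    exact le_top
  obtain ⟨ν, hν, hle⟩ := exists_dominating_lintegral_le hα₀ (ρ : Measure Ω) htop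
  calc ∑ y ∈ π.range, ENNReal.ofReal (Γ y) * ‖q (π ⁻¹' {y})‖ₑ
      ≤ ∫⁻ x, ENNReal.ofReal (Γ (π x)) ∂ν := sum_enorm_fiber_le hν π fun y => ENNReal.ofReal (Γ y)
    _ ≤ ∫⁻ x, (1 + ENNReal.ofReal ε) * atomWeight α (ρ : Measure Ω) x ∂ν := by
        refine lintegral_mono fun x => ?_
        refine (ENNReal.ofReal_le_ofReal (h x)).trans (ENNReal.ofReal_add_le.trans ?_)
        rw [add_mul, one_mul]
        exact add_le_add (ofReal_smoothedWeight_le hα₁ k ρ x)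
          (le_mul_of_one_le_right' (one_le_atomWeight hα₁ _ x))
    _ = (1 + ENNReal.ofReal ε) * ∫⁻ x, atomWeight α (ρ : Measure Ω) x ∂ν :=
        lintegral_const_mul' _ _ (by finiteness)
    _ ≤ _ := by gcongr

lemma integrable_riemannSum_mesh {q : I → VectorMeasure Ω (EuclideanSpace ℝ (Fin d))}
    (hq : IsL1Flux q) (n : ℕ) {f : I → Ω → EuclideanSpace ℝ (Fin d) →L[ℝ] ℝ}
    (hf : Continuous fun p : I × Ω => f p.1 p.2) :
    Integrable fun t => riemannSum (q t) (mesh Ω n) (f t) := by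
  obtain ⟨C, hC⟩ := isCompact_univ.exists_bound_of_continuousOn hf.continuousOn
  refine ⟨aestronglyMeasurable_riemannSum hq.1 _ hf, ?_⟩
  calc ∫⁻ t, ‖riemannSum (q t) (mesh Ω n) (f t)‖ₑ
      ≤ ∫⁻ t, ENNReal.ofReal C * massBound (q t) := by
        refine lintegral_mono fun t => (enorm_riemannSum_le (q t) _ fun x => ?_).trans
          (mul_le_mul_right (le_iSup (fun n => partitionMass (q t) (mesh Ω n)) n) _)
        rw [← ofReal_norm]
        exact ENNReal.ofReal_le_ofReal (hC (t, x) (mem_univ _))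
    _ = ENNReal.ofReal C * ∫⁻ t, massBound (q t) := lintegral_const_mul' _ _ (by finiteness)
    _ < ⊤ := ENNReal.mul_lt_top (by finiteness) (lintegral_massBound_ne_top hq).lt_top

lemma enorm_integral_pairing_sub_le {q : I → VectorMeasure Ω (EuclideanSpace ℝ (Fin d))}
    (hq : IsL1Flux q) {τ : I → I} (hτ : Continuous τ) (n : ℕ)
    {f : I → Ω → EuclideanSpace ℝ (Fin d) →L[ℝ] ℝ} (hf : Continuous fun p : I × Ω => f p.1 p.2)
    {ε : ℝ} (h : ∀ s x, ‖f s x - f s (mesh Ω n x)‖ ≤ ε) :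
    ‖(∫ t, pairing (q t) (f (τ t))) - ∫ z, f z.1 z.2.1 z.2.2 ∂liftedMeasure q τ (mesh Ω n)‖ₑ ≤
      ENNReal.ofReal ε * ∫⁻ t, (q t).variation univ := by
  have hfτ : Continuous fun p : I × Ω => f (τ p.1) p.2 :=
    hf.comp ((hτ.comp continuous_fst).prodMk continuous_snd)
  rw [integral_liftedMeasure hq hτ _ hf, ← integral_sub
    (integrable_pairing hq (f := fun t => f (τ t)) hfτ)
    (integrable_riemannSum_mesh hq n (f := fun t => f (τ t)) hfτ)]
  refine (enorm_integral_le_lintegral_enorm _).trans ?_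
  rw [← lintegral_const_mul' _ _ (by finiteness)]
  refine lintegral_mono fun t => enorm_integral_sub_riemannSum_le (q t) _
    (hf.comp ((continuous_const (y := τ t)).prodMk continuous_id)) fun x => ?_
  rw [← ofReal_norm]
  exact ENNReal.ofReal_le_ofReal (h _ x)

variable {p : ℕ → Pair Ω} {τ : ℕ → I ≃o I} {U : Filter ℕ} {ρ : C(I, ProbabilityMeasure Ω)}
  {Ms : ℕ → FiniteMeasure (I × Ω × UnitBall d)} {M : FiniteMeasure (I × Ω × UnitBall d)}

/-- The time term converges because the integrands do so uniformly, the flux term by weak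
convergence, and the discretization error vanishes thanks to the common mass bound `B`. -/
lemma liftedEquation_of_tendsto [U.NeBot] (hU : U ≤ atTop) (hq : ∀ n, IsL1Flux (p n).2)
    (hc : ∀ n, ContinuityEquation (p n)) {B : ℝ≥0∞} (hB : B ≠ ⊤)
    (hvar : ∀ n, ∫⁻ t, ((p n).2 t).variation univ ≤ B)
    (hρ : ∀ t, Tendsto (fun z : ℕ × I => (p z.1).1 ((τ z.1).symm z.2)) (U ×ˢ 𝓝 t) (𝓝 (ρ t)))
    (hMs : ∀ n, (Ms n : Measure (I × Ω × UnitBall d)) =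
      liftedMeasure (p n).2 (τ n) (mesh Ω n)) (hM : Tendsto Ms U (𝓝 M)) :
    LiftedEquation ρ (M : Measure (I × Ω × UnitBall d)) := by
  intro φ hφ h0
  have hdc := continuous_deriv_left_subtype (Ω := Ω) hφ
  have hfc := continuous_fderiv_right_subtype (Ω := Ω) hφ
  let A : ℕ → I → ℝ := fun n s => ∫ x : Ω,
    deriv (fun r => φ (r, (x : EuclideanSpace ℝ (Fin d)))) s ∂((p n).1 ((τ n).symm s) : Measure Ω)
  let A' : I → ℝ := fun s => ∫ x : Ω,
    deriv (fun r => φ (r, (x : EuclideanSpace ℝ (Fin d)))) s ∂(ρ s : Measure Ω)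
  let f : I → Ω → EuclideanSpace ℝ (Fin d) →L[ℝ] ℝ := fun t x =>
    fderiv ℝ (fun y => φ ((t : ℝ), y)) (x : EuclideanSpace ℝ (Fin d))
  have hA' : Continuous A' := continuous_integral_curve ρ.continuous hdc
  have hA : ∀ n, Continuous (A n) := fun n =>
    continuous_integral_curve ((p n).1.continuous.comp (τ n).symm.continuous) hdc
  have hunif : TendstoUniformly A A' U := by
    refine tendstoUniformly_of_continuousConvergence hA' fun t => ?_
    exact ((continuous_integral_param (f := fun (s : I) (x : Ω) =>
      deriv (fun r => φ (r, (x : EuclideanSpace ℝ (Fin d)))) s) hdc).tendsto (ρ t, t)).comp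
      (by rw [nhds_prod_eq]; exact (hρ t).prodMk tendsto_snd)
  have h1 : Tendsto (fun n => ∫ s, A n s) U (𝓝 (∫ s, A' s)) := by
    rw [Metric.tendsto_nhds]
    intro ε hε
    filter_upwards [Metric.tendstoUniformly_iff.1 hunif (ε / 2) (half_pos hε)] with n hn
    rw [dist_eq_norm, ← integral_sub (integrable_continuous _ (hA n))
      (integrable_continuous _ hA')]
    have := norm_integral_le_of_norm_le_const (μ := (volume : Measure I)) (C := ε / 2)
      (f := fun s => A n s - A' s) (ae_of_all _ fun s => by
        rw [← dist_eq_norm, dist_comm]; exact (hn s).le)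
    rw [probReal_univ, mul_one] at this
    linarith
  have hF : Continuous fun z : I × Ω × UnitBall d => f z.1 z.2.1 z.2.2 :=
    (hfc.comp (continuous_fst.prodMk (continuous_fst.comp continuous_snd))).clm_apply
      (continuous_subtype_val.comp (continuous_snd.comp continuous_snd))
  have h2 : Tendsto (fun n => ∫ z, f z.1 z.2.1 z.2.2 ∂(Ms n : Measure (I × Ω × UnitBall d))) U
      (𝓝 (∫ z, f z.1 z.2.1 z.2.2 ∂(M : Measure (I × Ω × UnitBall d)))) :=
    ((FiniteMeasure.continuous_integral_continuousMap
      (⟨_, hF⟩ : C(I × Ω × UnitBall d, ℝ))).tendsto M).comp hM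
  have h3 : Tendsto (fun n => (∫ t, pairing ((p n).2 t) (f (τ n t))) -
      ∫ z, f z.1 z.2.1 z.2.2 ∂(Ms n : Measure (I × Ω × UnitBall d))) U (𝓝 0) := by
    rw [Metric.tendsto_nhds]
    intro ε hε
    -- The tolerance is divided by `B + 1`, since `B` may be zero.
    have hB1 : 0 < B.toReal + 1 := by positivity
    filter_upwards [hU (eventually_dist_mesh_le hfc (div_pos hε hB1))] with n hn
    rw [dist_zero_right, hMs n]
    have h := (enorm_integral_pairing_sub_le (hq n) (τ n).continuous n (f := f) hfc
      (fun s x => by rw [← dist_eq_norm]; exact (hn s x).le)).trans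
      (mul_le_mul_right (hvar n) _)
    have h' := ENNReal.toReal_mono (by finiteness) h
    rw [toReal_enorm, ENNReal.toReal_mul, ENNReal.toReal_ofReal (div_pos hε hB1).le] at h'
    refine h'.trans_lt ?_
    rw [div_mul_eq_mul_div, div_lt_iff₀ hB1]
    nlinarith
  have h4 := (h1.add h2).add h3
  have h5 : ∀ n, (∫ s, A n s) + (∫ z, f z.1 z.2.1 z.2.2 ∂(Ms n : Measure (I × Ω × UnitBall d))) +
      ((∫ t, pairing ((p n).2 t) (f (τ n t))) -
        ∫ z, f z.1 z.2.1 z.2.2 ∂(Ms n : Measure (I × Ω × UnitBall d))) = 0 := fun n => by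
    rw [← continuityEquation_timeChange (hq n) (hc n) (τ n) hφ h0]
    ring
  simp only [h5, add_zero] at h4
  exact (tendsto_nhds_unique h4 tendsto_const_nhds)

/-- For fixed `k` the weight along the limit curve is a legitimate continuous test function. It is
within `ε / 2` of the weight along the `n`-th curve, and the mesh costs another `ε / 2`. -/
lemma lintegral_smoothedWeight_le_of_tendsto [U.NeBot] (hU : U ≤ atTop) {α : ℝ} (hα₀ : 0 < α)
    (hα₁ : α < 1) (hq : ∀ n, IsL1Flux (p n).2) {m : ℝ≥0∞} (hm : m ≠ ⊤)
    (hcost : Tendsto (fun n => totalCost α (p n)) U (𝓝 m))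
    (hρ : ∀ t, Tendsto (fun z : ℕ × I => (p z.1).1 ((τ z.1).symm z.2)) (U ×ˢ 𝓝 t) (𝓝 (ρ t)))
    (hMs : ∀ n, (Ms n : Measure (I × Ω × UnitBall d)) =
      liftedMeasure (p n).2 (τ n) (mesh Ω n)) (hM : Tendsto Ms U (𝓝 M)) (k : ℕ) :
    ∫⁻ z, ENNReal.ofReal (smoothedWeight α k (ρ z.1) z.2.1)
      ∂(M : Measure (I × Ω × UnitBall d)) ≤ m := by
  have hΓ := continuous_smoothedWeight_curve α k ρ.continuous
  have hunif : TendstoUniformly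
      (fun n (z : I × Ω) => smoothedWeight α k ((p n).1 ((τ n).symm z.1)) z.2)
      (fun z => smoothedWeight α k (ρ z.1) z.2) U := by
    refine tendstoUniformly_of_continuousConvergence hΓ fun z => ?_
    refine ((continuous_smoothedWeight α k).tendsto (ρ z.1, z.2)).comp
      (f := fun y : ℕ × I × Ω => ((p y.1).1 ((τ y.1).symm y.2.1), y.2.2)) ?_
    refine Tendsto.prodMk_nhds ((hρ z.1).comp (f := fun y : ℕ × I × Ω => (y.1, y.2.1)) ?_) ?_
    · exact tendsto_fst.prodMk ((continuous_fst.tendsto z).comp tendsto_snd)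
    · exact (continuous_snd.tendsto z).comp tendsto_snd
  have hΓ' : Continuous fun z : I × Ω × UnitBall d => smoothedWeight α k (ρ z.1) z.2.1 :=
    hΓ.comp (continuous_fst.prodMk (continuous_fst.comp continuous_snd))
  have hlim : Tendsto (fun n => ∫⁻ z, ENNReal.ofReal (smoothedWeight α k (ρ z.1) z.2.1)
      ∂(Ms n : Measure (I × Ω × UnitBall d))) U
      (𝓝 (∫⁻ z, ENNReal.ofReal (smoothedWeight α k (ρ z.1) z.2.1)
        ∂(M : Measure (I × Ω × UnitBall d)))) :=
    ((FiniteMeasure.continuous_lintegral_continuousMap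
      (⟨_, continuous_real_toNNReal.comp hΓ'⟩ : C(I × Ω × UnitBall d, NNReal))).tendsto M).comp hM
  have key : ∀ ε > 0, ∫⁻ z, ENNReal.ofReal (smoothedWeight α k (ρ z.1) z.2.1)
      ∂(M : Measure (I × Ω × UnitBall d)) ≤ (1 + ENNReal.ofReal ε) * m := by
    intro ε hε
    refine le_of_tendsto_of_tendsto hlim
      (ENNReal.Tendsto.const_mul hcost (Or.inr (by finiteness))) ?_
    filter_upwards [Metric.tendstoUniformly_iff.1 hunif (ε / 2) (half_pos hε),
      hU (eventually_dist_mesh_le hΓ (half_pos hε))] with n hn1 hn2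
    rw [hMs n, lintegral_liftedMeasure (hq n).1 (τ n).continuous.measurable _
      hΓ'.measurable.ennreal_ofReal, totalCost, ← lintegral_const_mul' _ _ (by finiteness)]
    refine lintegral_mono fun t => ?_
    refine sum_ofReal_mul_enorm_le hα₀ hα₁ ((p n).1 t) ((p n).2 t) (mesh Ω n)
      (Γ := fun y => smoothedWeight α k (ρ (τ n t)) y) (k := k) fun x => ?_
    have e1 := hn1 (τ n t, x)
    have e2 := hn2 (τ n t) x
    rw [Real.dist_eq, abs_lt] at e1 e2
    simp only [OrderIso.symm_apply_apply] at e1 e2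
    linarith [e1.2, e2.1]
  have hlim0 : Tendsto (fun ε : ℝ => (1 + ENNReal.ofReal ε) * m) (𝓝[>] 0) (𝓝 m) := by
    have : Continuous fun ε : ℝ => (1 + ENNReal.ofReal ε) * m :=
      (ENNReal.continuous_mul_const hm).comp
        (continuous_const.add ENNReal.continuous_ofReal)
    have h := this.tendsto 0
    simp only [ENNReal.ofReal_zero, add_zero, one_mul] at h
    exact h.mono_left nhdsWithin_le_nhds
  exact ge_of_tendsto hlim0 (eventually_mem_nhdsWithin.mono fun ε hε => key ε hε)

/-- Fatou's lemma in `k`; the smoothing is removed only after the limit in `n`. -/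
lemma lintegral_atomWeight_le {α : ℝ} {m : ℝ≥0∞} (M : Measure (I × Ω × UnitBall d))
    (h : ∀ k, ∫⁻ z, ENNReal.ofReal (smoothedWeight α k (ρ z.1) z.2.1) ∂M ≤ m) :
    ∫⁻ z, atomWeight α (ρ z.1 : Measure Ω) z.2.1 ∂M ≤ m := by
  have hmeas : ∀ k, Measurable fun z : I × Ω × UnitBall d =>
      ENNReal.ofReal (smoothedWeight α k (ρ z.1) z.2.1) := fun k =>
    ((continuous_smoothedWeight_curve α k ρ.continuous).comp
      (continuous_fst.prodMk (continuous_fst.comp continuous_snd))).measurable.ennreal_ofReal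
  calc ∫⁻ z, atomWeight α (ρ z.1 : Measure Ω) z.2.1 ∂M
      = ∫⁻ z, liminf (fun k => ENNReal.ofReal (smoothedWeight α k (ρ z.1) z.2.1)) atTop ∂M := by
        simp_rw [(tendsto_smoothedWeight α _ _).liminf_eq]
    _ ≤ liminf (fun k => ∫⁻ z, ENNReal.ofReal (smoothedWeight α k (ρ z.1) z.2.1) ∂M) atTop :=
        lintegral_liminf_le hmeas
    _ ≤ m := (liminf_le_liminf (Eventually.of_forall h)).trans (by simp)

lemma lintegral_variation_le_totalCost {α : ℝ} (hα₀ : 0 < α) (hα₁ : α < 1) (p : Pair Ω) :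
    ∫⁻ t, (p.2 t).variation univ ≤ totalCost α p :=
  lintegral_mono fun _ => variation_le_instantCost hα₀ hα₁ _ _

/-- Compactness and lower semicontinuity: a sequence of admissible pairs with bounded costs
produces an admissible pair whose cost is at most the limit of the costs. -/
theorem exists_admissible_totalCost_le {α : ℝ} (hα₀ : 0 < α) (hα₁ : α < 1)
    {μ₀ μ₁ : ProbabilityMeasure Ω} (hp : ∀ n, p n ∈ admissible μ₀ μ₁) {B m : ℝ≥0∞} (hB : B ≠ ⊤)
    (hcB : ∀ n, totalCost α (p n) ≤ B)
    (hcost : Tendsto (fun n => totalCost α (p n)) atTop (𝓝 m)) :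
    ∃ p ∈ admissible μ₀ μ₁, totalCost α p ≤ m := by
  have hm : m ≠ ⊤ := ne_top_of_le_ne_top hB (le_of_tendsto' hcost hcB)
  have hvar : ∀ n, ∫⁻ t, ((p n).2 t).variation univ ≤ B := fun n =>
    (lintegral_variation_le_totalCost hα₀ hα₁ (p n)).trans (hcB n)
  -- `B` bounds the flux mass, and 1 is the length of the time interval added in the time change.
  let C : ℝ := (B + 1).toReal
  have hC : ENNReal.ofReal C = B + 1 := ENNReal.ofReal_toReal (by finiteness)
  have hmass : ∀ n, ∫⁻ t, (massBound ((p n).2 t) + 1) ≤ ENNReal.ofReal C := fun n => by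
    rw [hC, lintegral_add_right _ measurable_const]
    simp only [lintegral_const, measure_univ, mul_one]
    gcongr
    exact (lintegral_mono fun t => massBound_le_variation _).trans (hvar n)
  choose τ hτ using fun n => exists_timeChange (lintegral_massBound_ne_top (hp n).1)
  -- Along an ultrafilter the curves converge at all times at once and the lifted measures converge
  -- too, without extracting subsequences.
  let U : Ultrafilter ℕ := hyperfilter ℕ
  have hU : (U : Filter ℕ) ≤ atTop := by
    rw [← Nat.cofinite_eq_atTop]; exact hyperfilter_le_cofinite
  let ρs : ℕ → I → ProbabilityMeasure Ω := fun n s => (p n).1 ((τ n).symm s)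
  have hL : ∀ ψ : EuclideanSpace ℝ (Fin d) → ℝ, ContDiff ℝ ∞ ψ → ∃ L : ℝ, ∀ n s t,
      |∫ x : Ω, ψ x ∂(ρs n s : Measure Ω) - ∫ x : Ω, ψ x ∂(ρs n t : Measure Ω)|
        ≤ L * dist s t := by
    intro ψ hψ
    obtain ⟨L, hL⟩ := isCompact_univ.exists_bound_of_continuousOn
      ((hψ.continuous_fderiv (by simp)).comp (continuous_subtype_val (p := (· ∈ Ω)))).continuousOn
    exact ⟨L * C, fun n s t => lipschitz_timeChange (hp n).1 (hp n).2.1 (hmass n)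
      ENNReal.toReal_nonneg (hτ n) hψ (fun x => hL x (mem_univ _)) s t⟩
  have hlim : ∀ t, ∃ μ : ProbabilityMeasure Ω, Tendsto (fun n => ρs n t) U (𝓝 μ) := fun t => by
    obtain ⟨μ, -, hμ⟩ := isCompact_univ.ultrafilter_le_nhds (U.map fun n => ρs n t) (by simp)
    exact ⟨μ, hμ⟩
  choose ρ₀ hρ₀ using hlim
  let ρ : C(I, ProbabilityMeasure Ω) := ⟨ρ₀, continuous_of_equiLipschitz fun ψ hψ => by
    obtain ⟨L, hL'⟩ := hL ψ hψ
    exact ⟨L, lipschitz_of_tendsto hψ.continuous hL' hρ₀⟩⟩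
  have hρ : ∀ t, Tendsto (fun z : ℕ × I => (p z.1).1 ((τ z.1).symm z.2)) (U ×ˢ 𝓝 t)
      (𝓝 (ρ t)) := tendsto_prod_of_equiLipschitz (ρs := ρs) hL hρ₀
  let Ms : ℕ → FiniteMeasure (I × Ω × UnitBall d) := fun n =>
    ⟨liftedMeasure (p n).2 (τ n) (mesh Ω n),
      isFiniteMeasure_liftedMeasure (hp n).1 (τ n).continuous.measurable _⟩
  have hfst : ∀ n, ((Ms n).map Prod.fst : Measure I) ≤ ENNReal.ofReal C • volume := fun n => by
    refine (fst_liftedMeasure_le (hp n).1 (τ n).continuous.measurable n).trans ?_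
    rw [hτ n]
    exact Measure.le_iff.2 fun s _ => mul_le_mul_left (hmass n) _
  have hMass : ∀ n, (Ms n).mass ≤ C.toNNReal := fun n => by
    have h := hfst n univ
    rw [FiniteMeasure.toMeasure_map, Measure.map_apply measurable_fst MeasurableSet.univ] at h
    rw [← ENNReal.coe_le_coe, FiniteMeasure.ennreal_mass]
    simpa [ENNReal.ofReal] using h
  obtain ⟨M, -, hM⟩ := (isCompact_setOfPred_finiteMeasure_le_of_compactSpace
    (I × Ω × UnitBall d) C.toNNReal).ultrafilter_le_nhds (U.map Ms)
    (le_principal_iff.2 (mem_map.2 (univ_mem' hMass)))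
  replace hM : Tendsto Ms U (𝓝 M) := hM
  have hMfst : (M : Measure (I × Ω × UnitBall d)).fst ≪ volume := by
    have : IsFiniteMeasure (ENNReal.ofReal C • (volume : Measure I)) :=
      Measure.smul_finite _ ENNReal.ofReal_ne_top
    have h := measure_le_of_tendsto
      (FiniteMeasure.tendsto_map_of_tendsto_of_continuous Ms M hM continuous_fst) hfst
    exact (Measure.absolutelyContinuous_of_le h).trans Measure.smul_absolutelyContinuous
  obtain ⟨q, hq, hc, hle⟩ := exists_flux_of_liftedEquation ρ M hMfst
    (liftedEquation_of_tendsto hU (fun n => (hp n).1) (fun n => (hp n).2.1) hB hvar hρ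
      (fun _ => rfl) hM)
  refine ⟨(ρ, q), ⟨hq, hc, ?_, ?_⟩, (hle α hα₀ hα₁).trans (lintegral_atomWeight_le _
    (lintegral_smoothedWeight_le_of_tendsto hU hα₀ hα₁ (fun n => (hp n).1) hm
      (hcost.mono_left hU) hρ (fun _ => rfl) hM))⟩
  -- The time changes are increasing bijections, so they fix the endpoints and the boundary values
  -- persist.
  · refine tendsto_nhds_unique (hρ₀ 0) (tendsto_const_nhds.congr fun n => ?_)
    exact ((congrArg (p n).1 (τ n).symm.map_bot).trans (hp n).2.2.1).symm
  · refine tendsto_nhds_unique (hρ₀ 1) (tendsto_const_nhds.congr fun n => ?_)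
    exact ((congrArg (p n).1 (τ n).symm.map_top).trans (hp n).2.2.2).symm

end Limit

end BranchedTransport

end

theorem mainTheorem1 {d : ℕ} {Ω : Set (EuclideanSpace ℝ (Fin d))}
    (hΩ : IsCompact Ω) (hconv : Convex ℝ Ω) {α : ℝ} (hα₀ : 0 < α) (hα₁ : α < 1)
    (μ₀ μ₁ : ProbabilityMeasure Ω) :
    ∃ p ∈ BranchedTransport.admissible μ₀ μ₁,
      IsMinOn (BranchedTransport.totalCost α) (BranchedTransport.admissible μ₀ μ₁) p := by
  have : CompactSpace Ω := isCompact_iff_compactSpace.1 hΩ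
  have : Nonempty Ω := nonempty_of_isProbabilityMeasure (μ₀ : Measure Ω)
  let S := BranchedTransport.totalCost α '' BranchedTransport.admissible μ₀ μ₁
  have hne := BranchedTransport.exists_admissible hconv μ₀ μ₁
  obtain ⟨u, hu, hlim, hmem⟩ := exists_seq_tendsto_sInf (hne.image (BranchedTransport.totalCost α))
    (OrderBot.bddBelow _)
  have hmin : ∀ p, BranchedTransport.totalCost α p ≤ sInf S →
      IsMinOn (BranchedTransport.totalCost α) (BranchedTransport.admissible μ₀ μ₁) p :=
    fun p hp p' hp' => hp.trans (sInf_le (mem_image_of_mem _ hp'))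
  -- If the infimum is infinite, every admissible pair is a minimizer.
  by_cases htop : sInf S = ⊤
  · obtain ⟨p, hp⟩ := hne
    exact ⟨p, hp, hmin p (htop ▸ le_top)⟩
  -- The minimizing sequence of values is antitone, so dropping its first `N` terms leaves costs
  -- bounded by the finite value `u N`.
  obtain ⟨N, hN⟩ := (hlim.eventually_lt_const (lt_top_iff_ne_top.2 htop)).exists
  choose p hp hpu using hmem
  obtain ⟨q, hq, hle⟩ := BranchedTransport.exists_admissible_totalCost_le hα₀ hα₁
    (p := fun n => p (n + N)) (fun n => hp _) hN.ne
    (fun n => (hpu _).le.trans (hu (Nat.le_add_left N n)))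
    (by simpa only [hpu] using (tendsto_add_atTop_iff_nat N).2 hlim)
  exact ⟨q, hq, hmin q hle⟩
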